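/- **Setting.** For $N\ge 2$, $\beta\ge 0$, $h\ge 0$ consider the Sherrington–Kirkpatrick model on $\{-1,+1\}^N$ with $$-H_N(\sigma,\beta,h)=\frac{\beta}{\sqrt N}\sum_{1\le i<j\le N}g_{i,j}\sigma_i\sigma_j+h\sum_{i\le N}\sigma_i ,$$ where the $g_{i,j}$ are i.i.d. standard Gaussian variables. For a function $f$ of $k$ replicas $\sigma^1,\dots,\sigma^k$ let $\langle f\rangle$ be its integral with respect to the $k$-fold product of the Gibbs measure $G_N(\sigma)\propto\exp(-H_N(\sigma,\beta,h))$, and $\nu(f)=E\langle f\rangle$. Let $z$ be a standard Gaussian variable independent of the $g_{i,j}$, and let $q_2$ be a solution of $E\tanh^2(\beta z\sqrt{q_2}+h)=q_2$. Write $\sigma=(\rho,\varepsilon)$ with $\rho=(\sigma_1,\dots,\sigma_{N-1})$, $\varepsilon=\sigma_N$. For $t\in[0,1]$ let $\langle\cdot\rangle_t$ and $\nu_t(f)=E\langle f\rangle_t$ be defined in the same way from the Hamiltonian $$-H_{N,t}(\sigma)=-H_{N-1}\Big(\rho,\beta\sqrt{\tfrac{N-1}{N}},h\Big)+\varepsilon\Big(\sqrt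 t\,\frac{\beta}{\sqrt N}\sum_{i\le N-1}g_{i,N}\sigma_i+\sqrt{1-t}\,\beta z\sqrt{q_2}+h\Big),$$ and let $\nu_0^{(l)}(f)$ be the $l$-th derivative at $t=0$ of $t\mapsto\nu_t(f)$ on $[0,1]$. Given $2p$ replicas put $\tilde\sigma_i^r=\sigma_i^{2r-1}-\sigma_i^{2r}$, $\tilde\sigma_1^{\otimes p}=\prod_{r=1}^p\tilde\sigma_1^r$ and $\tilde\varepsilon^{\otimes p}=\prod_{r=1}^p\tilde\sigma_N^r$. Let $\tilde\gamma_{i,j}=\langle(\sigma_i^1-\sigma_i^2)(\sigma_j^1-\sigma_j^2)\rangle$. For a fixed $\beta_0$, $F=O(k)$ means that $|F|\le K N^{-k/2}$ for all $N\ge2$ and $0\le\beta\le\beta_0$, with a constant $K$ independent of $N$ and $\beta$ (it may depend on $h$, $p$, $l$). **Theorem.** There is $\beta_0>0$ such that for every $h\ge0$ the following hold. 1. For all $0\le\beta\le\beta_0$, $N\ge2$ and $p\ge0$, the function $t\mapsto\nu_t(\tilde\varepsilon^{\otimes p}\tilde\sigma_1^{\otimes p})$ is $C^\infty$ on $[0,1]$;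 and for all integers $p,l\ge0$ with $2l>p$, $$\nu_0^{(l)}(\tilde\varepsilon^{\otimes p}\tilde\sigma_1^{\otimes p})=O(p+1).$$ 2. If $p$ is odd, then $\nu(\tilde\varepsilon^{\otimes p}\tilde\sigma_1^{\otimes p})=O(p+1)$. 3. If $p=2q$ is even, then $\nu(\tilde\varepsilon^{\otimes p}\tilde\sigma_1^{\otimes p})=\frac1{q!}\,\nu_0^{(q)}(\tilde\varepsilon^{\otimes p}\tilde\sigma_1^{\otimes p})+O(p+1)$. 4. If $p$ is odd and $0\le\beta\le\beta_0$, then $E\big[(N^{1/2}\tilde\gamma_{i,j})^p\big]\to0$ as $N\to\infty$, uniformly over the pairs of distinct sites $i\ne j$. -/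

import Mathlib

open MeasureTheory ProbabilityTheory Set Filter
open scoped ContDiff Nat

noncomputable section

namespace SK

/-- Spin configurations on `N` sites, i.e. elements of `{-1, +1}^N`. -/
abbrev Config (N : ℕ) : Type := Fin N → ℤˣ

/-- The spin at site `i`, as a real number. -/
def spin {N : ℕ} (σ : Config N) (i : Fin N) : ℝ := ((σ i : ℤ) : ℝ)

/-- Pairs of sites `i < j`. -/
abbrev Pair (N : ℕ) : Type := {e : Fin N × Fin N // e.1 < e.2}

/-- A realisation of the couplings `g_{i,j}`, `i < j`. -/
abbrev Couplings (N : ℕ) : Type := Pair N → ℝ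

/-- The law of the couplings: i.i.d. standard Gaussian. -/
def couplingLaw (N : ℕ) : Measure (Couplings N) := Measure.pi fun _ => gaussianReal 0 1

/-- Minus the Sherrington-Kirkpatrick Hamiltonian with external field,
`-H_N(σ, β, h) = (β / √N) ∑_{i<j} g_{i,j} σ_i σ_j + h ∑_i σ_i`. -/
def negH (N : ℕ) (β h : ℝ) (g : Couplings N) (σ : Config N) : ℝ :=
  β / √(N : ℝ) * ∑ e : Pair N, g e * spin σ e.1.1 * spin σ e.1.2 + h * ∑ i, spin σ i

/-- The Gibbs weight of `σ` associated with the energy `A = -H`. -/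
def gibbs {N : ℕ} (A : Config N → ℝ) (σ : Config N) : ℝ :=
  Real.exp (A σ) / ∑ τ, Real.exp (A τ)

/-- The bracket `⟨f⟩`: the integral of a function `f` of `k` replicas with respect to the
`k`-fold product of the Gibbs measure. -/
def bracket {N k : ℕ} (A : Config N → ℝ) (f : (Fin k → Config N) → ℝ) : ℝ :=
  ∑ σ : Fin k → Config N, (∏ r, gibbs A (σ r)) * f σ

/-- `ν(f) = E⟨f⟩`. -/
def nu (N : ℕ) (β h : ℝ) {k : ℕ} (f : (Fin k → Config N) → ℝ) : ℝ :=
  ∫ g, bracket (negH N β h g) f ∂couplingLaw N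

/-- `q` solves `E tanh²(β z √q + h) = q`, where `z` is standard Gaussian. -/
def IsOverlapParameter (β h q : ℝ) : Prop :=
  ∫ z, Real.tanh (β * z * √q + h) ^ 2 ∂gaussianReal 0 1 = q

/-- An overlap parameter always exists. -/
theorem exists_isOverlapParameter (β h : ℝ) : ∃ q : ℝ, 0 ≤ q ∧ IsOverlapParameter β h q := by
  have hb : ∀ x : ℝ, Real.tanh x ^ 2 ≤ 1 := fun x => by
    nlinarith [Real.tanh_lt_one x, Real.neg_one_lt_tanh x]
  have ht : Continuous Real.tanh := by
    have : Real.tanh = fun x => Real.sinh x / Real.cosh x := funext Real.tanh_eq_sinh_div_cosh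
    rw [this]
    exact Real.continuous_sinh.div Real.continuous_cosh fun x => (Real.cosh_pos x).ne'
  set F : ℝ → ℝ := fun q => ∫ z, Real.tanh (β * z * √q + h) ^ 2 ∂gaussianReal 0 1 with hF
  have hc : Continuous F := by
    refine continuous_of_dominated (bound := fun _ => 1) (fun q => ?_) (fun q => ?_)
      (integrable_const _) ?_
    · exact Continuous.aestronglyMeasurable (by fun_prop)
    · exact Eventually.of_forall fun z => by
        rw [Real.norm_of_nonneg (sq_nonneg _)]; exact hb _
    · exact Eventually.of_forall fun z => by fun_prop
  have h0 : 0 ≤ F 0 := integral_nonneg fun z => sq_nonneg _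
  have h1 : F 1 ≤ 1 := by
    have : F 1 ≤ ∫ _z, (1 : ℝ) ∂gaussianReal 0 1 :=
      integral_mono_of_nonneg (Eventually.of_forall fun z => sq_nonneg _) (integrable_const _)
        (Eventually.of_forall fun z => hb _)
    simpa using this
  obtain ⟨q, hq, hq'⟩ := intermediate_value_Icc' (zero_le_one' ℝ)
    (f := fun q => F q - q) (hc.sub continuous_id).continuousOn
    (show (0 : ℝ) ∈ Icc (F 1 - 1) (F 0 - 0) from ⟨by linarith, by linarith⟩)
  exact ⟨q, hq.1, sub_eq_zero.1 hq'⟩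

/-- The configuration `ρ` made of all spins but the last one. -/
def init {n : ℕ} (σ : Config (n + 1)) : Config n := fun i => σ i.castSucc

/-- The couplings between the sites other than the last one. -/
def initCouplings {n : ℕ} (g : Couplings (n + 1)) : Couplings n :=
  fun e => g ⟨(e.1.1.castSucc, e.1.2.castSucc), Fin.castSucc_lt_castSucc_iff.2 e.2⟩

/-- `g(ρ) = (β / √N) ∑_{i ≤ N-1} g_{i,N} σ_i`, where `N = n + 1`. -/
def cavityField {n : ℕ} (β : ℝ) (g : Couplings (n + 1)) (ρ : Config n) : ℝ :=
  β / √((n + 1 : ℕ) : ℝ) *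
    ∑ i : Fin n, g ⟨(i.castSucc, Fin.last n), Fin.castSucc_lt_last i⟩ * spin ρ i

/-- Minus the Hamiltonian of the smart path on `N = n + 1` sites,
`-H_{N,t}(σ) = -H_{N-1}(ρ, β⁻, h) + ε (√t g(ρ) + √(1-t) β z √q + h)`, where `ε = σ_N` and
`β⁻ = β √((N-1)/N)`. -/
def negHPath {n : ℕ} (β h q t : ℝ) (g : Couplings (n + 1)) (z : ℝ) (σ : Config (n + 1)) : ℝ :=
  negH n (β * √((n : ℝ) / ((n + 1 : ℕ) : ℝ))) h (initCouplings g) (init σ) +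
    spin σ (Fin.last n) *
      (√t * cavityField β g (init σ) + √(1 - t) * (β * z * √q) + h)

/-- `ν_t(f) = E⟨f⟩_t` on `N = n + 1` sites; the expectation is over the couplings and over an
independent standard Gaussian `z`. -/
def nuPath (n : ℕ) (β h q : ℝ) {k : ℕ} (f : (Fin k → Config (n + 1)) → ℝ) (t : ℝ) : ℝ :=
  ∫ x, bracket (negHPath β h q t x.1 x.2) f ∂(couplingLaw (n + 1)).prod (gaussianReal 0 1)

/-- `ν_0^{(l)}(f)`: the derivative of order `l` at `t = 0` of `t ↦ ν_t(f)`, `t ∈ [0, 1]`. -/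
def nuZeroDeriv (n : ℕ) (β h q : ℝ) (l : ℕ) {k : ℕ} (f : (Fin k → Config (n + 1)) → ℝ) : ℝ :=
  iteratedDerivWithin l (nuPath n β h q f) (Icc 0 1) 0

/-- `σ̃_i^r = σ_i^{2r-1} - σ_i^{2r}`; with indices starting at `0`, the two replicas are those of
index `2r` and `2r + 1`. -/
def spinDiff {N p : ℕ} (σ : Fin (2 * p) → Config N) (r : Fin p) (i : Fin N) : ℝ :=
  spin (σ ⟨2 * r, by omega⟩) i - spin (σ ⟨2 * r + 1, by omega⟩) i

/-- `ε̃^{⊗p} σ̃_1^{⊗p}`, a function of `2p` replicas on `N = n + 1` sites: the product over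
`r = 1, …, p` of the spin differences at the last site, times that at the first site. -/
def diffProd (n p : ℕ) (σ : Fin (2 * p) → Config (n + 1)) : ℝ :=
  (∏ r, spinDiff σ r (Fin.last n)) * ∏ r, spinDiff σ r 0

/-- The symmetrised covariance `γ̃_{i,j} = ⟨(σ_i^1 - σ_i^2)(σ_j^1 - σ_j^2)⟩`. -/
def symCov (N : ℕ) (β h : ℝ) (g : Couplings N) (i j : Fin N) : ℝ :=
  bracket (k := 2) (negH N β h g) fun σ =>
    (spin (σ 0) i - spin (σ 1) i) * (spin (σ 0) j - spin (σ 1) j)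

/-- The relation `F = O(k)` at field `h`: `|F| ≤ K / N^{k/2}` with `K` independent of
`β ∈ [0, β₀]` and of `N = n + 1 ≥ 2`. Here `q` is the overlap parameter attached to `β, h`. -/
def IsO (β₀ h : ℝ) (k : ℕ) (F : (n : ℕ) → (β q : ℝ) → ℝ) : Prop :=
  ∃ K : ℝ, ∀ β ∈ Icc 0 β₀, ∀ q : ℝ, IsOverlapParameter β h q → ∀ n : ℕ, 1 ≤ n →
    |F n β q| ≤ K / ((n + 1 : ℕ) : ℝ) ^ ((k : ℝ) / 2)

end SK

end

/-!
The proof is the cavity method at high temperature, organised so that orders in `N^{-1/2}` can be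
counted.

*Replicas.* Functions of replicas are functions of an infinite sequence of configurations that
depend on finitely many of them (`DependsOn`), and `avg` is their Gibbs average. Moving the energy
in a direction `v` multiplies the integrand by a combination of the `v (σ r)` that involves one
more replica (`hasDerivAt_avg_gibbs`). With Gaussian integration by parts, the derivative of `ν_t`
becomes a mean of the same kind: `ν_t'(F)` is a linear combination of the
`β² ν_t(F ε_a ε_b (R⁻_{a,b} - q))` over pairs of distinct replicas `a`, `b`, two of them new
(`hasDerivWithinAt_pathMean`). The right-hand side is continuous up to the endpoints, where `√t` and
`√(1 - t)` are not differentiable, so `ν_t(F)` is smooth on `[0, 1]` and its derivatives are given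
by iterating the formula (`pathMeanDeriv_succ`). When sites are removed the strength `β / √N` of
the couplings is kept, and overlaps are normalised by the original `N`; the same `q` then serves
for the systems with `N`, `N - 1` and `N - 2` sites, and no continuity of `q` in `β` is needed.

*Size of the overlap.* By induction on `m`, the moment of order `2m` of `R⁻ - q` is `O(N^{-m})`
all along the path, for `β ≤ 1/20` whatever `m` (`exists_moment_bound`). By symmetry between sites
one factor `R - q` may be replaced by `ε₁ε₂ - q`. The resulting mean vanishes at `t = 0` by the
equation for `q`, and its derivative is at most a small multiple of the moment itself, by
`cavMean_le_two_mul`; everything else is of lower order. Hence each derivative in `t` gains a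
factor `N^{-1/2}` (`exists_pathMeanDeriv_bound`).

*Parity.* At `t = 0` the last spins are independent of the others. A product of `p` differences of
last spins averages to zero as soon as some difference involves replicas that occur nowhere else,
because exchanging these two replicas changes the sign. Each derivative brings in two last spins,
so the derivatives of order `l < p / 2` vanish at `0` (`pathMeanDeriv_splitFun_eq_zero`). If
`l > p / 2`, there remain at `t = 0` means of `σ̃_1^{⊗p}` times at least `l` deviations of overlaps
in the system of `N - 1` sites. Applying the same cavity argument to site `1` of that system gains
`⌈p / 2⌉` further factors, whence `O(p + 1)` (`exists_diffMon_bound`,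
`exists_pathMeanDeriv_zero_bound`). Taylor's formula of order `p` at `t = 0` then leaves only the
term `l = p / 2` (`exists_taylor_bound`). Finally `E γ̃_{i,j}^p = ν(ε̃^{⊗p} σ̃_1^{⊗p})` by symmetry
between sites (`integral_symCov_pow`).
-/

noncomputable section

namespace SK

/-! ### Averages over replicas and derivatives of Gibbs averages -/

/-- The infinite sequence of replicas that starts with the `k` replicas of `σ`; the replicas of
index at least `k` have a default value. It allows functions of any number of replicas to be
treated as functions on one space, `ℕ → S`. -/
def toSeq {S : Type*} [Inhabited S] {k : ℕ} (σ : Fin k → S) (r : ℕ) : S :=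
  if h : r < k then σ ⟨r, h⟩ else default

/-- The sum of `F` over the first `k` replicas, each replica having the weights `w`. It is the
average of `F` under `k` independent replicas if `w` is a probability vector and `F` depends on
the first `k` replicas only. -/
def avg {S : Type*} [Inhabited S] [Fintype S] (k : ℕ) (w : S → ℝ) (F : (ℕ → S) → ℝ) : ℝ :=
  ∑ σ : Fin k → S, (∏ r, w (σ r)) * F (toSeq σ)

theorem dependsOn_mono {S X : Type*} {F : (ℕ → S) → X} {A B : Set ℕ} (hF : DependsOn F A)
    (h : A ⊆ B) : DependsOn F B :=
  fun _ _ hst => hF fun r hr => hst r (h hr)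

theorem DependsOn.update_eq {S : Type*} {F : (ℕ → S) → ℝ} {k m : ℕ} (hF : DependsOn F (Iio k))
    (h : k ≤ m) (σ : ℕ → S) (s : S) : F (Function.update σ m s) = F σ :=
  hF fun _ hr => Function.update_of_ne ((lt_of_lt_of_le hr h).ne) _ _

theorem toSeq_of_lt {S : Type*} [Inhabited S] {k : ℕ} (σ : Fin k → S) {r : ℕ} (h : r < k) :
    toSeq σ r = σ ⟨r, h⟩ := by
  simp [toSeq, h]

theorem toSeq_val {S : Type*} [Inhabited S] {k : ℕ} (σ : Fin k → S) (r : Fin k) :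
    toSeq σ r = σ r := by
  simp [toSeq]

theorem toSeq_snoc {S : Type*} [Inhabited S] {k : ℕ} (σ : Fin k → S) (s : S) :
    toSeq (Fin.snoc σ s : Fin (k + 1) → S) = Function.update (toSeq σ) k s := by
  funext r
  rcases lt_trichotomy r k with h | h | h
  · rw [Function.update_of_ne h.ne, toSeq_of_lt _ h, toSeq_of_lt _ (h.trans k.lt_succ_self)]
    exact Fin.snoc_castSucc (α := fun _ => S) s σ ⟨r, h⟩
  · subst h
    rw [Function.update_self, toSeq_of_lt _ r.lt_succ_self]
    exact Fin.snoc_last (α := fun _ => S) s σ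
  · rw [Function.update_of_ne h.ne']
    simp only [toSeq]
    rw [dif_neg (by omega), dif_neg (by omega)]

section Average

variable {S : Type*} [Inhabited S] [Fintype S] {k : ℕ} {w : S → ℝ} {F G : (ℕ → S) → ℝ}

theorem avg_succ (k : ℕ) (w : S → ℝ) (F : (ℕ → S) → ℝ) :
    avg (k + 1) w F = ∑ s, w s * avg k w fun σ => F (Function.update σ k s) := by
  unfold avg
  rw [← (Fin.snocEquiv fun _ : Fin (k + 1) => S).sum_comp, Fintype.sum_prod_type]
  refine Finset.sum_congr rfl fun s _ => ?_
  rw [Finset.mul_sum]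
  refine Finset.sum_congr rfl fun σ _ => ?_
  have : (Fin.snocEquiv fun _ : Fin (k + 1) => S) (s, σ) = Fin.snoc σ s := rfl
  rw [this, toSeq_snoc, Fin.prod_univ_castSucc]
  simp only [Fin.snoc_castSucc, Fin.snoc_last]
  ring

theorem avg_add : avg k w (fun σ => F σ + G σ) = avg k w F + avg k w G := by
  simp only [avg, mul_add, Finset.sum_add_distrib]

theorem avg_sub : avg k w (fun σ => F σ - G σ) = avg k w F - avg k w G := by
  simp only [avg, mul_sub, Finset.sum_sub_distrib]

theorem avg_const_mul (c : ℝ) : avg k w (fun σ => c * F σ) = c * avg k w F := by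
  simp only [avg, Finset.mul_sum]
  exact Finset.sum_congr rfl fun σ _ => by ring

theorem avg_sum {ι : Type*} (s : Finset ι) (F : ι → (ℕ → S) → ℝ) :
    avg k w (fun σ => ∑ i ∈ s, F i σ) = ∑ i ∈ s, avg k w (F i) := by
  simp only [avg, Finset.mul_sum]
  exact Finset.sum_comm

theorem avg_mono (hw : ∀ s, 0 ≤ w s) (h : ∀ σ, F σ ≤ G σ) : avg k w F ≤ avg k w G :=
  Finset.sum_le_sum fun _ _ =>
    mul_le_mul_of_nonneg_left (h _) (Finset.prod_nonneg fun _ _ => hw _)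

theorem abs_avg_le (hw : ∀ s, 0 ≤ w s) : |avg k w F| ≤ avg k w fun σ => |F σ| := by
  refine (Finset.abs_sum_le_sum_abs _ _).trans (Finset.sum_le_sum fun _ _ => ?_)
  rw [abs_mul, abs_of_nonneg (Finset.prod_nonneg fun _ _ => hw _)]

theorem avg_congr (h : ∀ σ, F σ = G σ) : avg k w F = avg k w G := by
  rw [show F = G from funext h]

theorem avg_const (hw : ∑ s, w s = 1) (c : ℝ) : avg k w (fun _ => c) = c := by
  induction k with
  | zero => simp [avg]
  | succ k ih => rw [avg_succ, ← Finset.sum_mul, hw, one_mul, ih]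

theorem avg_of_dependsOn (hw : ∑ s, w s = 1) (hF : DependsOn F (Iio k)) {m : ℕ} (h : k ≤ m) :
    avg m w F = avg k w F := by
  induction m, h using Nat.le_induction with
  | base => rfl
  | succ m h ih =>
    rw [avg_succ, ← ih]
    have : ∀ s, (avg m w fun σ => F (Function.update σ m s)) = avg m w F := fun s =>
      avg_congr fun σ => DependsOn.update_eq hF h σ s
    rw [Finset.sum_congr rfl fun s _ => by rw [this s], ← Finset.sum_mul, hw, one_mul]

/-- Exchanging two of the replicas does not change the average. -/
theorem avg_swap (w : S → ℝ) (F : (ℕ → S) → ℝ) {a b : ℕ} (ha : a < k) (hb : b < k) :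
    avg k w (fun σ => F (σ ∘ Equiv.swap a b)) = avg k w F := by
  unfold avg
  set e : Equiv.Perm (Fin k) := Equiv.swap ⟨a, ha⟩ ⟨b, hb⟩ with he
  rw [← (Equiv.arrowCongr e (Equiv.refl S)).sum_comp]
  refine Finset.sum_congr rfl fun σ _ => ?_
  have h1 : ∀ r, (Equiv.arrowCongr e (Equiv.refl S)) σ r = σ (e r) := fun r => by
    simp [Equiv.arrowCongr, he]
  congr 1
  · simp only [h1]
    exact Equiv.prod_comp e fun r => w (σ r)
  · change F _ = F _
    congr 1
    funext r
    simp only [Function.comp_apply]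
    by_cases hr : r < k
    · rw [toSeq_of_lt σ hr]
      have h2 : Equiv.swap a b r = (e ⟨r, hr⟩ : ℕ) := by
        simp only [he, Equiv.swap_apply_def, Fin.ext_iff]
        split_ifs <;> rfl
      rw [h2, toSeq_val, h1, he, Equiv.swap_apply_self]
    · rw [Equiv.swap_apply_of_ne_of_ne (by omega) (by omega)]
      simp [toSeq, hr]

theorem avg_pair (hw : ∑ s, w s = 1) (u : S → S → ℝ) {a b : ℕ} (hab : a ≠ b) (ha : a < k)
    (hb : b < k) :
    avg k w (fun σ => u (σ a) (σ b)) = avg 2 w fun σ => u (σ 0) (σ 1) := by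
  have hd : DependsOn (fun σ : ℕ → S => u (σ 0) (σ 1)) (Iio 2) := fun σ τ h => by
    simp only
    rw [h 0 (by simp), h 1 (by simp)]
  rw [← avg_of_dependsOn hw hd (by omega : 2 ≤ k),
    ← avg_swap w (fun σ => u (σ 0) (σ 1)) (show Equiv.swap 0 a b < k by
      rw [Equiv.swap_apply_def]; split_ifs <;> omega) (show 1 < k by omega),
    ← avg_swap w _ (show 0 < k by omega) ha]
  refine avg_congr fun σ => ?_
  have h0 : Equiv.swap 0 a b ≠ 0 := by
    rw [Equiv.swap_apply_def]; split_ifs <;> omega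
  simp only [Function.comp_apply, Equiv.swap_apply_right]
  rw [Equiv.swap_apply_of_ne_of_ne h0.symm (by norm_num)]

end Average

section Gibbs

variable {N k : ℕ}

theorem bracket_comp_toSeq (A : Config N → ℝ) (F : (ℕ → Config N) → ℝ) :
    bracket (k := k) A (fun σ => F (toSeq σ)) = avg k (gibbs A) F := rfl

theorem sum_exp_pos (A : Config N → ℝ) : 0 < ∑ τ, Real.exp (A τ) :=
  Finset.sum_pos (fun _ _ => Real.exp_pos _) Finset.univ_nonempty

theorem gibbs_nonneg (A : Config N → ℝ) (σ : Config N) : 0 ≤ gibbs A σ :=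
  div_nonneg (Real.exp_pos _).le (sum_exp_pos A).le

theorem sum_gibbs (A : Config N → ℝ) : ∑ σ, gibbs A σ = 1 := by
  simp only [gibbs, ← Finset.sum_div]
  exact div_self (sum_exp_pos A).ne'

theorem abs_avg_gibbs_le {F : (ℕ → Config N) → ℝ} {C : ℝ} (hF : ∀ σ, |F σ| ≤ C)
    (A : Config N → ℝ) : |avg k (gibbs A) F| ≤ C :=
  ((abs_avg_le (gibbs_nonneg A)).trans (avg_mono (gibbs_nonneg A) hF)).trans_eq
    (avg_const (sum_gibbs A) C)

theorem hasDerivAt_gibbs {A : ℝ → Config N → ℝ} {A' : Config N → ℝ} {t : ℝ}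
    (hA : ∀ τ, HasDerivAt (fun u => A u τ) (A' τ) t) (σ : Config N) :
    HasDerivAt (fun u => gibbs (A u) σ)
      (gibbs (A t) σ * (A' σ - ∑ τ, gibbs (A t) τ * A' τ)) t := by
  have h1 : HasDerivAt (fun u => ∑ τ, Real.exp (A u τ)) (∑ τ, Real.exp (A t τ) * A' τ) t :=
    HasDerivAt.fun_sum fun τ _ => (hA τ).exp
  refine ((hA σ).exp.div h1 (sum_exp_pos _).ne').congr_deriv ?_
  have h2 : ∑ τ, gibbs (A t) τ * A' τ =
      (∑ τ, Real.exp (A t τ) * A' τ) / ∑ τ, Real.exp (A t τ) := by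
    rw [Finset.sum_div]
    exact Finset.sum_congr rfl fun τ _ => by rw [gibbs]; ring
  rw [h2, gibbs]
  have := (sum_exp_pos (A t)).ne'
  field_simp

/-- The function of `k + 1` replicas whose Gibbs average is the derivative of the Gibbs average
of `F`, a function of `k` replicas, when the energy moves in the direction `v`. -/
def repDeriv {S : Type*} (k : ℕ) (v : S → ℝ) (F : (ℕ → S) → ℝ) (σ : ℕ → S) : ℝ :=
  F σ * (∑ r ∈ Finset.range k, v (σ r) - k * v (σ k))

theorem dependsOn_repDeriv {S : Type*} {k : ℕ} (v : S → ℝ) {F : (ℕ → S) → ℝ}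
    (hF : DependsOn F (Iio k)) : DependsOn (repDeriv k v F) (Iio (k + 1)) := by
  intro σ τ h
  have h' : ∀ r, r < k + 1 → σ r = τ r := fun r hr => h r hr
  simp only [repDeriv]
  rw [hF fun r hr => h' r (Nat.lt_succ_of_lt hr), h' k k.lt_succ_self,
    Finset.sum_congr rfl fun r hr => by rw [h' r (Nat.lt_succ_of_lt (Finset.mem_range.1 hr))]]

theorem hasDerivAt_avg_gibbs {A : ℝ → Config N → ℝ} {A' : Config N → ℝ} {t : ℝ}
    (hA : ∀ τ, HasDerivAt (fun u => A u τ) (A' τ) t) {F : (ℕ → Config N) → ℝ}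
    (hF : DependsOn F (Iio k)) :
    HasDerivAt (fun u => avg k (gibbs (A u)) F)
      (avg (k + 1) (gibbs (A t)) (repDeriv k A' F)) t := by
  unfold avg
  have h1 : ∀ σ : Fin k → Config N, HasDerivAt (fun u => (∏ r, gibbs (A u) (σ r)) * F (toSeq σ))
      (((∏ r, gibbs (A t) (σ r)) * ∑ r, (A' (σ r) - ∑ τ, gibbs (A t) τ * A' τ)) * F (toSeq σ))
      t := fun σ => by
    refine HasDerivAt.mul_const ?_ _
    have := HasDerivAt.fun_finsetProd (u := Finset.univ) fun r (_ : r ∈ Finset.univ) =>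
      hasDerivAt_gibbs hA (σ r)
    refine this.congr_deriv ?_
    rw [Finset.mul_sum]
    refine Finset.sum_congr rfl fun r _ => ?_
    rw [smul_eq_mul, ← Finset.mul_prod_erase Finset.univ _ (Finset.mem_univ r)]
    ring
  refine (HasDerivAt.fun_sum fun σ _ => h1 σ).congr_deriv ?_
  have h2 := avg_succ k (gibbs (A t)) (repDeriv k A' F)
  unfold avg at h2
  rw [h2]
  have h3 : ∀ (σ : ℕ → Config N) s, repDeriv k A' F (Function.update σ k s) =
      F σ * (∑ r ∈ Finset.range k, A' (σ r) - k * A' s) := fun σ s => by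
    simp only [repDeriv, Function.update_self]
    rw [DependsOn.update_eq hF le_rfl,
      Finset.sum_congr rfl fun r hr => by
        rw [Function.update_of_ne (Finset.mem_range.1 hr).ne]]
  simp only [h3, Finset.mul_sum]
  rw [Finset.sum_comm]
  refine Finset.sum_congr rfl fun σ _ => ?_
  have h4 : ∑ r ∈ Finset.range k, A' (toSeq σ r) = ∑ r, A' (σ r) := by
    rw [Finset.sum_range]
    exact Finset.sum_congr rfl fun r _ => by rw [toSeq_val]
  simp only [h4]
  have h5 : ∀ X Y Z : ℝ, ∑ i, gibbs (A t) i * (X * (Y * (Z - k * A' i))) =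
      X * Y * (Z - k * ∑ i, gibbs (A t) i * A' i) := fun X Y Z => by
    have : ∀ i, gibbs (A t) i * (X * (Y * (Z - k * A' i))) =
      gibbs (A t) i * (X * Y * Z) - X * Y * k * (gibbs (A t) i * A' i) := fun i => by ring
    simp only [this, Finset.sum_sub_distrib, ← Finset.sum_mul, ← Finset.mul_sum, sum_gibbs]
    ring
  rw [h5, ← Finset.mul_sum, Finset.sum_sub_distrib]
  simp
  ring

end Gibbs

/-! ### Gaussian integration by parts -/

theorem continuous_avg_gibbs {X : Type*} [TopologicalSpace X] {N : ℕ} {A : X → Config N → ℝ}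
    (hA : ∀ σ, Continuous fun x => A x σ) (k : ℕ) (F : (ℕ → Config N) → ℝ) :
    Continuous fun x => avg k (gibbs (A x)) F := by
  unfold avg
  refine continuous_finsetSum _ fun σ _ => Continuous.mul ?_ continuous_const
  refine continuous_finsetProd _ fun r _ => ?_
  unfold gibbs
  exact (hA _).rexp.div (continuous_finsetSum _ fun τ _ => (hA τ).rexp)
    fun x => (sum_exp_pos _).ne'

section Gaussian

theorem integrable_id_gaussian : Integrable (fun x : ℝ => x) (gaussianReal 0 1) := by
  have := (memLp_id_gaussianReal (μ := 0) (v := 1) 1)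
  exact memLp_one_iff_integrable.1 this

/-- Gaussian integration by parts in dimension one. -/
theorem integral_id_mul_gaussian {f f' : ℝ → ℝ} (hf : ∀ x, HasDerivAt f (f' x) x) {C C' : ℝ}
    (hC : ∀ x, |f x| ≤ C) (hC' : ∀ x, |f' x| ≤ C') :
    ∫ x, x * f x ∂gaussianReal 0 1 = ∫ x, f' x ∂gaussianReal 0 1 := by
  have hp : ∀ x, HasDerivAt (gaussianPDFReal 0 1) (-x * gaussianPDFReal 0 1 x) x := fun x => by
    have h1 : HasDerivAt (fun x : ℝ => -x ^ 2 / 2) (-x) x := by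
      refine (((hasDerivAt_pow 2 x).neg).div_const 2).congr_deriv ?_
      simp
      ring
    have h2 := (h1.exp).const_mul ((√(2 * Real.pi))⁻¹)
    have h3 : gaussianPDFReal 0 1 = fun x => (√(2 * Real.pi))⁻¹ * Real.exp (-x ^ 2 / 2) := by
      funext x
      simp [gaussianPDFReal]
    rw [h3]
    refine h2.congr_deriv ?_
    ring
  have hfm : Measurable f := (continuous_iff_continuousAt.2 fun x => (hf x).continuousAt).measurable
  have hfm' : Measurable f' := by
    rw [show f' = deriv f from funext fun x => ((hf x).deriv).symm]
    exact measurable_deriv f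
  have hpi := integrable_gaussianPDFReal 0 1
  have hxp : Integrable fun x => x * gaussianPDFReal 0 1 x := by
    have := integrable_mul_exp_neg_mul_sq (b := 1 / 2) (by norm_num)
    refine (this.const_mul ((√(2 * Real.pi))⁻¹)).congr (ae_of_all _ fun x => ?_)
    simp only [gaussianPDFReal, NNReal.coe_one, mul_one, sub_zero]
    rw [show -(1 / 2 : ℝ) * x ^ 2 = -x ^ 2 / 2 by ring]
    ring
  rw [integral_gaussianReal_eq_integral_smul one_ne_zero,
    integral_gaussianReal_eq_integral_smul one_ne_zero]
  have h := integral_mul_deriv_eq_deriv_mul_of_integrable (u := f) (v := gaussianPDFReal 0 1)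
    (u' := f') (v' := fun x => -x * gaussianPDFReal 0 1 x) (fun x _ => hf x) (fun x _ => hp x)
    ?_ ?_ ?_
  · have e1 : ∀ x, gaussianPDFReal 0 1 x • (x * f x) = -(f x * (-x * gaussianPDFReal 0 1 x)) :=
      fun x => by rw [smul_eq_mul]; ring
    have e2 : ∀ x, gaussianPDFReal 0 1 x • f' x = f' x * gaussianPDFReal 0 1 x :=
      fun x => by rw [smul_eq_mul]; ring
    simp only [e1, e2, integral_neg, h, neg_neg]
  · refine (hxp.neg.bdd_mul (c := C) hfm.aestronglyMeasurable (ae_of_all _ hC)).congr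
      (ae_of_all _ fun x => ?_)
    simp
  · exact hpi.bdd_mul (c := C') hfm'.aestronglyMeasurable (ae_of_all _ hC')
  · exact hpi.bdd_mul (c := C) hfm.aestronglyMeasurable (ae_of_all _ hC)

variable {ι : Type*} [Fintype ι]

/-- The standard Gaussian measure on `ι → ℝ`. -/
abbrev gaussianPi (ι : Type*) [Fintype ι] : Measure (ι → ℝ) := Measure.pi fun _ => gaussianReal 0 1

theorem integrable_eval_gaussianPi (e : ι) : Integrable (fun x : ι → ℝ => x e) (gaussianPi ι) :=
  (measurePreserving_eval (fun _ : ι => gaussianReal 0 1) e).integrable_comp_of_integrable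
    integrable_id_gaussian

variable {N : ℕ}

/-- The energy of `σ` that is linear in independent Gaussian variables `x e`, with the
coefficients `c e * v e σ`, plus the deterministic energy `b σ`. -/
def linEnergy (c : ι → ℝ) (v : ι → Config N → ℝ) (b : Config N → ℝ) (x : ι → ℝ)
    (σ : Config N) : ℝ :=
  ∑ e, c e * v e σ * x e + b σ

theorem continuous_linEnergy (c : ι → ℝ) (v : ι → Config N → ℝ) (b : Config N → ℝ)
    (σ : Config N) : Continuous fun x => linEnergy c v b x σ := by
  unfold linEnergy; fun_prop

theorem exists_bound (F : (ℕ → Config N) → ℝ) {k : ℕ} (hF : DependsOn F (Iio k)) :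
    ∃ C, ∀ σ, |F σ| ≤ C := by
  obtain ⟨C, hC⟩ := (Set.finite_range fun σ : Fin k → Config N => |F (toSeq σ)|).bddAbove
  refine ⟨C, fun σ => ?_⟩
  rw [hF (y := toSeq fun r : Fin k => σ r) fun r hr =>
    (toSeq_of_lt (fun r : Fin k => σ r) hr).symm]
  exact hC (mem_range_self _)

variable [DecidableEq ι]

/-- Redrawing one coordinate independently preserves the standard Gaussian measure. -/
theorem measurePreserving_update (e : ι) :
    MeasurePreserving (fun p : (ι → ℝ) × ℝ => Function.update p.1 e p.2)
      ((gaussianPi ι).prod (gaussianReal 0 1)) (gaussianPi ι) := by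
  have hm : Measurable fun p : (ι → ℝ) × ℝ => Function.update p.1 e p.2 :=
    measurable_pi_iff.2 fun i => by
      by_cases h : i = e
      · subst h; simpa using measurable_snd
      · simp only [Function.update_of_ne h]; fun_prop
  refine ⟨hm, (Measure.pi_eq fun s hs => ?_).symm⟩
  rw [Measure.map_apply hm (MeasurableSet.univ_pi hs)]
  have : (fun p : (ι → ℝ) × ℝ => Function.update p.1 e p.2) ⁻¹' (univ.pi s) =
      (univ.pi (Function.update s e univ)) ×ˢ s e := by
    ext p
    simp only [mem_preimage, mem_univ_pi, mem_prod]
    constructor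
    · intro h
      refine ⟨fun i => ?_, by simpa using h e⟩
      by_cases hi : i = e
      · subst hi; simp
      · simpa [Function.update_of_ne hi] using h i
    · rintro ⟨h, h'⟩ i
      by_cases hi : i = e
      · subst hi; simpa using h'
      · simpa [Function.update_of_ne hi] using h i
  rw [this, Measure.prod_prod, Measure.pi_pi,
    ← Finset.mul_prod_erase Finset.univ _ (Finset.mem_univ e),
    ← Finset.mul_prod_erase Finset.univ (fun i => gaussianReal 0 1 (s i)) (Finset.mem_univ e)]
  rw [Function.update_self, measure_univ, one_mul, mul_comm]
  congr 1
  exact Finset.prod_congr rfl fun i hi => by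
    rw [Function.update_of_ne (Finset.ne_of_mem_erase hi)]

/-- Gaussian integration by parts along one coordinate. -/
theorem integral_eval_mul_gaussianPi (e : ι) {H H' : (ι → ℝ) → ℝ} {C C' : ℝ}
    (hH : ∀ x, HasDerivAt (fun y => H (Function.update x e y)) (H' x) (x e))
    (hm : Measurable H) (hm' : Measurable H') (hC : ∀ x, |H x| ≤ C) (hC' : ∀ x, |H' x| ≤ C') :
    ∫ x, x e * H x ∂gaussianPi ι = ∫ x, H' x ∂gaussianPi ι := by
  have hp := measurePreserving_update e
  have i1 : Integrable (fun x => x e * H x) (gaussianPi ι) := by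
    refine ((integrable_eval_gaussianPi e).bdd_mul (c := C) hm.aestronglyMeasurable
      (ae_of_all _ hC)).congr (ae_of_all _ fun x => mul_comm _ _)
  have i2 : Integrable H' (gaussianPi ι) :=
    Integrable.of_bound hm'.aestronglyMeasurable C' (ae_of_all _ hC')
  have j1 := hp.integrable_comp_of_integrable i1
  have j2 := hp.integrable_comp_of_integrable i2
  simp only [Function.comp_def] at j1 j2
  rw [← hp.map_eq, integral_map hp.measurable.aemeasurable (by rw [hp.map_eq]; exact i1.1),
    integral_map hp.measurable.aemeasurable (by rw [hp.map_eq]; exact i2.1),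
    integral_prod _ j1,
    integral_prod _ j2]
  refine integral_congr_ae (ae_of_all _ fun x => ?_)
  simp only [Function.update_self]
  refine integral_id_mul_gaussian (C := C) (C' := C') (fun y => ?_) (fun y => hC _) fun y => hC' _
  simpa using hH (Function.update x e y)

theorem integral_eval_mul_avg (e : ι) (c : ι → ℝ) (v : ι → Config N → ℝ) (b : Config N → ℝ)
    {k : ℕ} {F : (ℕ → Config N) → ℝ} (hF : DependsOn F (Iio k)) :
    ∫ x, x e * avg k (gibbs (linEnergy c v b x)) F ∂gaussianPi ι =
      c e * ∫ x, avg (k + 1) (gibbs (linEnergy c v b x)) (repDeriv k (v e) F) ∂gaussianPi ι := by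
  obtain ⟨C, hC⟩ := exists_bound F hF
  obtain ⟨C', hC'⟩ := exists_bound _ (dependsOn_repDeriv (fun σ => c e * v e σ) hF)
  have h := integral_eval_mul_gaussianPi e
    (H := fun x => avg k (gibbs (linEnergy c v b x)) F)
    (H' := fun x => avg (k + 1) (gibbs (linEnergy c v b x))
      (repDeriv k (fun σ => c e * v e σ) F)) (C := C) (C' := C') (fun x => ?_)
    (continuous_avg_gibbs (continuous_linEnergy c v b) _ _).measurable
    (continuous_avg_gibbs (continuous_linEnergy c v b) _ _).measurable
    (fun x => abs_avg_gibbs_le hC _) fun x => abs_avg_gibbs_le hC' _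
  · rw [h, ← integral_const_mul]
    refine integral_congr_ae (ae_of_all _ fun x => ?_)
    simp only
    rw [← avg_const_mul]
    refine avg_congr fun σ => ?_
    simp only [repDeriv, ← Finset.mul_sum]
    ring
  · have := hasDerivAt_avg_gibbs (A := fun y => linEnergy c v b (Function.update x e y))
      (A' := fun σ => c e * v e σ) (t := x e) (fun τ => ?_) hF
    · simpa using this
    · unfold linEnergy
      refine HasDerivAt.add_const _ ?_
      have h1 : ∀ i ∈ Finset.univ, HasDerivAt (fun y => c i * v i τ * Function.update x e y i)
          (if i = e then c e * v e τ else 0) (x e) := fun i _ => by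
        by_cases hi : i = e
        · subst hi
          simpa using (hasDerivAt_id (x i)).const_mul (c i * v i τ)
        · simpa [hi] using hasDerivAt_const (x e) (c i * v i τ * x i)
      refine (HasDerivAt.fun_sum h1).congr_deriv ?_
      simp

/-- Gaussian interpolation: the derivative of the mean Gibbs average of `F` when the coefficients
of the Gaussian variables move. -/
theorem hasDerivAt_integral_avg {c c' : ι → ℝ → ℝ} {t ε B : ℝ} (hε : 0 < ε)
    (hc : ∀ e, ∀ u ∈ Metric.ball t ε, HasDerivAt (c e) (c' e u) u)
    (hB : ∀ e, ∀ u ∈ Metric.ball t ε, |c' e u| ≤ B) (v : ι → Config N → ℝ) (b : Config N → ℝ)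
    {k : ℕ} {F : (ℕ → Config N) → ℝ} (hF : DependsOn F (Iio k)) :
    HasDerivAt (fun u => ∫ x, avg k (gibbs (linEnergy (fun e => c e u) v b x)) F ∂gaussianPi ι)
      (∑ e, c' e t * c e t * ∫ x, avg (k + 2) (gibbs (linEnergy (fun e => c e t) v b x))
        (repDeriv (k + 1) (v e) (repDeriv k (v e) F)) ∂gaussianPi ι) t := by
  obtain ⟨C, hC⟩ := exists_bound F hF
  choose D hD using fun e => exists_bound _ (dependsOn_repDeriv (v e) hF)
  have hcont : ∀ u k (F : (ℕ → Config N) → ℝ),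
      Continuous fun x => avg k (gibbs (linEnergy (fun e => c e u) v b x)) F := fun u k F =>
    continuous_avg_gibbs (continuous_linEnergy _ v b) k F
  have ht : t ∈ Metric.ball t ε := Metric.mem_ball_self hε
  have h := hasDerivAt_integral_of_dominated_loc_of_deriv_le (μ := gaussianPi ι)
    (F := fun u x => avg k (gibbs (linEnergy (fun e => c e u) v b x)) F)
    (F' := fun u x => ∑ e, c' e u * (x e *
      avg (k + 1) (gibbs (linEnergy (fun e => c e u) v b x)) (repDeriv k (v e) F)))
    (bound := fun x => ∑ e, B * (|x e| * D e)) (x₀ := t) (s := Metric.ball t ε)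
    (Metric.ball_mem_nhds t hε) (Eventually.of_forall fun u => (hcont u k F).aestronglyMeasurable)
    (Integrable.of_bound (hcont t k F).aestronglyMeasurable C
      (ae_of_all _ fun x => abs_avg_gibbs_le hC _)) ?_ ?_ ?_ ?_
  · refine h.2.congr_deriv ?_
    rw [integral_finsetSum]
    · refine Finset.sum_congr rfl fun e _ => ?_
      rw [integral_const_mul, integral_eval_mul_avg e _ v b (dependsOn_repDeriv (v e) hF),
        mul_assoc]
    · intro e _
      refine Integrable.const_mul ?_ _
      refine ((integrable_eval_gaussianPi e).bdd_mul (c := D e)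
        (hcont t (k + 1) (repDeriv k (v e) F)).aestronglyMeasurable
        (ae_of_all _ fun x => abs_avg_gibbs_le (hD e) _)).congr
        (ae_of_all _ fun x => mul_comm _ _)
  · refine Continuous.aestronglyMeasurable (continuous_finsetSum _ fun e _ => ?_)
    exact continuous_const.mul ((continuous_apply e).mul (hcont _ _ _))
  · refine ae_of_all _ fun x u hu => (norm_sum_le _ _).trans (Finset.sum_le_sum fun e _ => ?_)
    rw [norm_mul, norm_mul]
    have hB0 : 0 ≤ B := (abs_nonneg _).trans (hB e u hu)
    exact mul_le_mul (hB e u hu) (mul_le_mul_of_nonneg_left (abs_avg_gibbs_le (hD e) _)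
      (abs_nonneg _)) (by positivity) hB0
  · exact integrable_finsetSum _ fun e _ =>
      (((integrable_eval_gaussianPi e).abs).mul_const _).const_mul _
  · refine ae_of_all _ fun x u hu => ?_
    have := hasDerivAt_avg_gibbs (A := fun u => linEnergy (fun e => c e u) v b x)
      (A' := fun σ => ∑ e, c' e u * x e * v e σ) (t := u) (fun τ => ?_) hF
    · refine this.congr_deriv ?_
      have h2 : ∀ e, c' e u * (x e *
          avg (k + 1) (gibbs (linEnergy (fun e => c e u) v b x)) (repDeriv k (v e) F)) =
          avg (k + 1) (gibbs (linEnergy (fun e => c e u) v b x))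
            (fun σ => c' e u * x e * repDeriv k (v e) F σ) := fun e => by
        rw [avg_const_mul, mul_assoc]
      simp only [h2]
      rw [← avg_sum]
      refine avg_congr fun σ => ?_
      simp only [repDeriv]
      rw [Finset.sum_comm]
      simp only [Finset.mul_sum, mul_sub, Finset.sum_sub_distrib]
      congr 1
      · exact Finset.sum_congr rfl fun e _ => Finset.sum_congr rfl fun r _ => by ring
      · exact Finset.sum_congr rfl fun e _ => by ring
    · unfold linEnergy
      refine HasDerivAt.add_const _ ((HasDerivAt.fun_sum fun e _ =>
        (((hc e u hu).mul_const (v e τ)).mul_const (x e))).congr_deriv ?_)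
      exact Finset.sum_congr rfl fun e _ => by ring

end Gaussian

/-! ### Energies along the smart path -/

section Spin

variable {n : ℕ}

theorem spin_mul_self (σ : Config n) (i : Fin n) : spin σ i * spin σ i = 1 := by
  unfold spin
  rcases Int.units_eq_one_or (σ i) with h | h <;> simp [h]

theorem abs_spin (σ : Config n) (i : Fin n) : |spin σ i| = 1 := by
  unfold spin
  rcases Int.units_eq_one_or (σ i) with h | h <;> simp [h]

theorem spin_init (σ : Config (n + 1)) (i : Fin n) : spin (init σ) i = spin σ i.castSucc := rfl

/-- The deviation `R - q`, where `R = N⁻¹ ∑_i σ_i τ_i` is the overlap of two configurations. The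
normalisation `N` need not be the number of sites: in a cavity computation sites are removed, but
the strength of the couplings, and hence the normalisation, is kept. -/
def overlapDev (N : ℕ) (q : ℝ) (σ τ : Config n) : ℝ := (∑ i, spin σ i * spin τ i) / N - q

/-- The pairs of sites of `Fin (n + 1)` are those of `Fin n` and those containing the last site. -/
theorem sum_pair_succ (f : Pair (n + 1) → ℝ) :
    ∑ e, f e = ∑ e : Pair n, f ⟨(e.1.1.castSucc, e.1.2.castSucc),
      Fin.castSucc_lt_castSucc_iff.2 e.2⟩ +
      ∑ i : Fin n, f ⟨(i.castSucc, Fin.last n), Fin.castSucc_lt_last i⟩ := by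
  let u : Pair n ⊕ Fin n → Pair (n + 1) := Sum.elim
    (fun e => ⟨(e.1.1.castSucc, e.1.2.castSucc), Fin.castSucc_lt_castSucc_iff.2 e.2⟩)
    (fun i => ⟨(i.castSucc, Fin.last n), Fin.castSucc_lt_last i⟩)
  have hu : Function.Bijective u := by
    constructor
    · rintro (⟨⟨i, j⟩, h⟩ | i) (⟨⟨i', j'⟩, h'⟩ | i') hij
      · simpa [u] using hij
      · simp [u, (Fin.castSucc_lt_last _).ne] at hij
      · simp [u, (Fin.castSucc_lt_last _).ne'] at hij
      · simpa [u] using hij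
    · rintro ⟨⟨i, j⟩, h⟩
      have hi : i ≠ Fin.last n := (lt_of_lt_of_le h (Fin.le_last j)).ne
      obtain ⟨i, rfl⟩ := Fin.exists_castSucc_eq.2 hi
      by_cases hj : j = Fin.last n
      · subst hj
        exact ⟨Sum.inr i, rfl⟩
      · obtain ⟨j, rfl⟩ := Fin.exists_castSucc_eq.2 hj
        exact ⟨Sum.inl ⟨(i, j), Fin.castSucc_lt_castSucc_iff.1 h⟩, rfl⟩
  rw [← (Equiv.ofBijective u hu).sum_comp, Fintype.sum_sum_type]
  rfl

end Spin

section Energy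

variable {n : ℕ}

/-- Minus the Hamiltonian with external field `h`, the couplings being multiplied by `s`. -/
def sysEnergy (s h : ℝ) (g : Couplings n) (σ : Config n) : ℝ :=
  s * ∑ e : Pair n, g e * spin σ e.1.1 * spin σ e.1.2 + h * ∑ i, spin σ i

/-- `E⟨F⟩` for `k` replicas of the system of `n` sites with pair strength `s`. -/
def sysMean (n : ℕ) (s h : ℝ) (k : ℕ) (F : (ℕ → Config n) → ℝ) : ℝ :=
  ∫ g, avg k (gibbs (sysEnergy s h g)) F ∂couplingLaw n

/-- Minus the Hamiltonian of the smart path on `n + 1` sites, the couplings being multiplied by `s`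
and the Gaussian field that replaces them at the last site by `c`. -/
def pathEnergy (s h c t : ℝ) (g : Couplings (n + 1)) (z : ℝ) (σ : Config (n + 1)) : ℝ :=
  sysEnergy s h (initCouplings g) (init σ) + spin σ (Fin.last n) *
    (√t * (s * ∑ i : Fin n, g ⟨(i.castSucc, Fin.last n), Fin.castSucc_lt_last i⟩ *
      spin (init σ) i) + √(1 - t) * (c * z) + h)

/-- `E⟨F⟩_t` for `k` replicas, along the smart path of `pathEnergy`. -/
def pathMean (n : ℕ) (s h c : ℝ) (k : ℕ) (F : (ℕ → Config (n + 1)) → ℝ) (t : ℝ) : ℝ :=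
  ∫ x, avg k (gibbs (pathEnergy s h c t x.1 x.2)) F ∂(couplingLaw (n + 1)).prod (gaussianReal 0 1)

instance (n : ℕ) : IsProbabilityMeasure (couplingLaw n) := by
  unfold couplingLaw; infer_instance

theorem continuous_sysEnergy (s h : ℝ) (σ : Config n) :
    Continuous fun g => sysEnergy s h g σ := by
  unfold sysEnergy; fun_prop

theorem continuous_initCouplings : Continuous (initCouplings (n := n)) := by
  unfold initCouplings; fun_prop

theorem continuous_pathEnergy (s h c : ℝ) (σ : Config (n + 1)) :
    Continuous fun x : ℝ × (Couplings (n + 1) × ℝ) => pathEnergy s h c x.1 x.2.1 x.2.2 σ := by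
  unfold pathEnergy
  refine ((continuous_sysEnergy s h _).comp
    (continuous_initCouplings.comp (by fun_prop))).add ?_
  fun_prop

theorem continuous_pathEnergy_right (s h c t : ℝ) (σ : Config (n + 1)) :
    Continuous fun x : Couplings (n + 1) × ℝ => pathEnergy s h c t x.1 x.2 σ :=
  (continuous_pathEnergy s h c σ).comp (by fun_prop : Continuous fun x => (t, x))

/-- The coefficients of the Gaussian variables along the smart path; the index `none` stands for
the variable `z`. -/
def pathCoeff : Option (Pair (n + 1)) → ℝ → ℝ
  | none, t => √(1 - t)
  | some e, t => if e.1.2 = Fin.last n then √t else 1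

/-- The directions in the space of energies that go with the Gaussian variables. -/
def pathDir (s c : ℝ) : Option (Pair (n + 1)) → Config (n + 1) → ℝ
  | none, σ => c * spin σ (Fin.last n)
  | some e, σ => s * (spin σ e.1.1 * spin σ e.1.2)

theorem pathEnergy_eq_linEnergy (s h c t : ℝ) (g : Couplings (n + 1)) (z : ℝ) :
    pathEnergy s h c t g z = linEnergy (fun e => pathCoeff e t) (pathDir s c)
      (fun σ => h * ∑ i, spin σ i) fun o => o.elim z g := by
  funext σ
  simp only [pathEnergy, linEnergy, sysEnergy, Fintype.sum_option, sum_pair_succ, pathCoeff,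
    pathDir, Option.elim, (Fin.castSucc_lt_last _).ne, if_true, if_false, Fin.sum_univ_castSucc,
    spin_init, initCouplings, Finset.mul_sum, mul_add]
  have h1 : ∀ i : Fin n, spin σ (Fin.last n) *
      (√t * (s * (g ⟨(i.castSucc, Fin.last n), Fin.castSucc_lt_last i⟩ *
        spin σ i.castSucc))) =
      √t * (s * (spin σ i.castSucc * spin σ (Fin.last n))) *
        g ⟨(i.castSucc, Fin.last n), Fin.castSucc_lt_last i⟩ := fun i => by ring
  have h2 : ∀ e : Pair n, s * (g ⟨(e.1.1.castSucc, e.1.2.castSucc),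
        Fin.castSucc_lt_castSucc_iff.2 e.2⟩ * spin σ e.1.1.castSucc * spin σ e.1.2.castSucc) =
      1 * (s * (spin σ e.1.1.castSucc * spin σ e.1.2.castSucc)) *
        g ⟨(e.1.1.castSucc, e.1.2.castSucc), Fin.castSucc_lt_castSucc_iff.2 e.2⟩ :=
    fun e => by ring
  simp only [h1, h2]
  ring

/-- The couplings and the variable `z` together form a standard Gaussian vector. -/
theorem measurePreserving_elim (ι : Type*) [Fintype ι] :
    MeasurePreserving (fun (x : (ι → ℝ) × ℝ) (o : Option ι) => o.elim x.2 x.1)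
      ((gaussianPi ι).prod (gaussianReal 0 1)) (gaussianPi (Option ι)) := by
  have hm : Measurable fun (x : (ι → ℝ) × ℝ) (o : Option ι) => o.elim x.2 x.1 :=
    measurable_pi_iff.2 fun o => by
      cases o with
      | none => exact measurable_snd
      | some e => exact (measurable_pi_apply e).comp measurable_fst
  refine ⟨hm, (Measure.pi_eq fun s hs => ?_).symm⟩
  rw [Measure.map_apply hm (MeasurableSet.univ_pi hs)]
  have : (fun (x : (ι → ℝ) × ℝ) (o : Option ι) => o.elim x.2 x.1) ⁻¹' (univ.pi s) =
      (univ.pi fun e => s (some e)) ×ˢ s none := by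
    ext p
    simp only [mem_preimage, mem_univ_pi, mem_prod, Option.forall, Option.elim]
    tauto
  rw [this, Measure.prod_prod, Measure.pi_pi, Fintype.prod_option, mul_comm]

theorem pathMean_eq (s h c : ℝ) (k : ℕ) (F : (ℕ → Config (n + 1)) → ℝ) (t : ℝ) :
    pathMean n s h c k F t = ∫ x, avg k (gibbs (linEnergy (fun e => pathCoeff e t) (pathDir s c)
      (fun σ => h * ∑ i, spin σ i) x)) F ∂gaussianPi (Option (Pair (n + 1))) := by
  have hp := measurePreserving_elim (Pair (n + 1))
  rw [← hp.map_eq, integral_map hp.measurable.aemeasurable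
    (continuous_avg_gibbs (continuous_linEnergy _ _ _) _ _).aestronglyMeasurable]
  simp only [pathMean, pathEnergy_eq_linEnergy]
  rfl

/-- A standard Gaussian vector stays so when it is reindexed along an injection. -/
theorem measurePreserving_comp_injective {ι κ : Type*} [Fintype ι] [Fintype κ] {f : κ → ι}
    (hf : Function.Injective f) :
    MeasurePreserving (fun x : ι → ℝ => x ∘ f) (gaussianPi ι) (gaussianPi κ) := by
  have hm : Measurable fun x : ι → ℝ => x ∘ f :=
    measurable_pi_iff.2 fun e => measurable_pi_apply (f e)
  refine ⟨hm, ?_⟩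
  have h1 : iIndepFun (fun i (x : ι → ℝ) => x i) (gaussianPi ι) :=
    iIndepFun_pi (X := fun _ x => x) fun _ => aemeasurable_id
  have h2 := (iIndepFun_iff_map_fun_eq_pi_map fun e => (measurable_pi_apply (f e)).aemeasurable).1
    (h1.precomp hf)
  simp only [(measurePreserving_eval (fun _ : ι => gaussianReal 0 1) _).map_eq,
    Function.comp_def] at h2 ⊢
  rw [h2]

end Energy

/-! ### Derivatives along the smart path -/

section Path

variable {n : ℕ} {s h c : ℝ} {k : ℕ} {F G : (ℕ → Config (n + 1)) → ℝ}

theorem continuous_pathMean (s h c : ℝ) (hF : DependsOn F (Iio k)) :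
    Continuous (pathMean n s h c k F) := by
  obtain ⟨C, hC⟩ := exists_bound F hF
  unfold pathMean
  refine continuous_of_dominated (bound := fun _ => C) (fun t => ?_) (fun t => ?_)
    (integrable_const _) (ae_of_all _ fun x => ?_)
  · exact (continuous_avg_gibbs (continuous_pathEnergy_right s h c t) k F).aestronglyMeasurable
  · exact ae_of_all _ fun x => abs_avg_gibbs_le hC _
  · exact continuous_avg_gibbs
      (fun σ => (continuous_pathEnergy s h c σ).comp (by fun_prop : Continuous fun t => (t, x))) k F

theorem integrable_path (s h c t : ℝ) (hF : DependsOn F (Iio k)) :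
    Integrable (fun x : Couplings (n + 1) × ℝ => avg k (gibbs (pathEnergy s h c t x.1 x.2)) F)
      ((couplingLaw (n + 1)).prod (gaussianReal 0 1)) := by
  obtain ⟨C, hC⟩ := exists_bound F hF
  exact Integrable.of_bound
    (continuous_avg_gibbs (continuous_pathEnergy_right s h c t) k F).aestronglyMeasurable C
    (ae_of_all _ fun x => abs_avg_gibbs_le hC _)

theorem pathMean_add (t : ℝ) (hF : DependsOn F (Iio k)) (hG : DependsOn G (Iio k)) :
    pathMean n s h c k (fun σ => F σ + G σ) t =
      pathMean n s h c k F t + pathMean n s h c k G t := by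
  simp only [pathMean, avg_add]
  exact integral_add (integrable_path s h c t hF) (integrable_path s h c t hG)

theorem pathMean_const_mul (a t : ℝ) :
    pathMean n s h c k (fun σ => a * F σ) t = a * pathMean n s h c k F t := by
  simp only [pathMean, avg_const_mul, integral_const_mul]

theorem pathMean_sum {ι : Type*} (I : Finset ι) (F : ι → (ℕ → Config (n + 1)) → ℝ) (t : ℝ)
    (hF : ∀ i ∈ I, DependsOn (F i) (Iio k)) :
    pathMean n s h c k (fun σ => ∑ i ∈ I, F i σ) t = ∑ i ∈ I, pathMean n s h c k (F i) t := by
  simp only [pathMean, avg_sum]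
  exact integral_finsetSum _ fun i hi => integrable_path s h c t (hF i hi)

theorem pathMean_mono (t : ℝ) (hF : DependsOn F (Iio k)) (hG : DependsOn G (Iio k))
    (hFG : ∀ σ, F σ ≤ G σ) : pathMean n s h c k F t ≤ pathMean n s h c k G t :=
  integral_mono (integrable_path s h c t hF) (integrable_path s h c t hG) fun _ =>
    avg_mono (gibbs_nonneg _) hFG

theorem abs_pathMean_le (t : ℝ) (hF : DependsOn F (Iio k)) :
    |pathMean n s h c k F t| ≤ pathMean n s h c k (fun σ => |F σ|) t := by
  have hF' : DependsOn (fun σ => |F σ|) (Iio k) := fun σ τ hst => congrArg _ (hF hst)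
  refine abs_integral_le_integral_abs.trans ?_
  exact integral_mono (integrable_path s h c t hF).abs (integrable_path s h c t hF') fun _ =>
    abs_avg_le (gibbs_nonneg _)

theorem pathMean_const (a t : ℝ) : pathMean n s h c k (fun _ => a) t = a := by
  simp [pathMean, avg_const (sum_gibbs _)]

theorem pathMean_of_dependsOn (hF : DependsOn F (Iio k)) {m : ℕ} (hm : k ≤ m) (t : ℝ) :
    pathMean n s h c m F t = pathMean n s h c k F t := by
  simp only [pathMean, avg_of_dependsOn (sum_gibbs _) hF hm]

theorem pathMean_pair (u : Config (n + 1) → Config (n + 1) → ℝ) {a b : ℕ} (hab : a ≠ b)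
    (ha : a < k) (hb : b < k) (t : ℝ) :
    pathMean n s h c k (fun σ => u (σ a) (σ b)) t =
      pathMean n s h c 2 (fun σ => u (σ 0) (σ 1)) t := by
  simp only [pathMean, avg_pair (sum_gibbs _) u hab ha hb]

/-- The weights of the replicas in `repDeriv k`: weight `1` for the `k` replicas present, and `-k`
for the new one. -/
def repWeight (k a : ℕ) : ℝ := if a < k then 1 else if a = k then -k else 0

theorem sum_repWeight {S : Type*} (v : S → ℝ) (σ : ℕ → S) {k m : ℕ} (h : k < m) :
    ∑ a ∈ Finset.range m, repWeight k a * v (σ a) =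
      ∑ r ∈ Finset.range k, v (σ r) - k * v (σ k) := by
  induction m, h using Nat.le_induction with
  | base =>
    rw [Finset.sum_range_succ]
    have : ∀ a ∈ Finset.range k, repWeight k a * v (σ a) = v (σ a) := fun a ha => by
      rw [repWeight, if_pos (Finset.mem_range.1 ha), one_mul]
    rw [Finset.sum_congr rfl this, repWeight, if_neg (lt_irrefl k), if_pos rfl]
    ring
  | succ m hm ih =>
    have : repWeight k m = 0 := by
      rw [repWeight, if_neg (by omega), if_neg (by omega)]
    rw [Finset.sum_range_succ, ih, this]
    ring

theorem repDeriv_repDeriv {S : Type*} (k : ℕ) (v : S → ℝ) (F : (ℕ → S) → ℝ) (σ : ℕ → S) :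
    repDeriv (k + 1) v (repDeriv k v F) σ = F σ *
      ∑ x ∈ Finset.range (k + 2) ×ˢ Finset.range (k + 2),
        repWeight k x.1 * repWeight (k + 1) x.2 * (v (σ x.1) * v (σ x.2)) := by
  rw [repDeriv, repDeriv, ← sum_repWeight v σ (show k < k + 2 by omega),
    ← sum_repWeight v σ (show k + 1 < k + 2 by omega), mul_assoc, Finset.sum_mul_sum,
    Finset.sum_product]
  congr 1
  exact Finset.sum_congr rfl fun a _ => Finset.sum_congr rfl fun b _ => by ring

theorem sum_repWeight_mul_repWeight (k : ℕ) :
    ∑ a ∈ Finset.range (k + 2), repWeight k a * repWeight (k + 1) a = 0 := by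
  rw [Finset.sum_range_succ, Finset.sum_range_succ]
  have : ∀ a ∈ Finset.range k, repWeight k a * repWeight (k + 1) a = 1 := fun a ha => by
    have := Finset.mem_range.1 ha
    rw [repWeight, repWeight, if_pos this, if_pos (by omega), one_mul]
  rw [Finset.sum_congr rfl this]
  simp [repWeight]

/-- The pairs of distinct replicas among the first `m`. -/
abbrev repPairs (m : ℕ) : Finset (ℕ × ℕ) := (Finset.range m).offDiag

/-- Half the derivative of the covariance of the energies of `σ` and `τ` along the smart path. -/
def covDeriv (s c : ℝ) (σ τ : Config (n + 1)) : ℝ :=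
  spin σ (Fin.last n) * spin τ (Fin.last n) *
    (s ^ 2 * ∑ i, spin (init σ) i * spin (init τ) i - c ^ 2) / 2

/-- The function of `k + 2` replicas whose mean is the derivative of the mean of `F`, a function of
`k` replicas, along the smart path. Only pairs of distinct replicas occur: as the spins are `±1`,
the others contribute a constant, times a sum of weights that vanishes. -/
def pathDeriv (s c : ℝ) (k : ℕ) (F : (ℕ → Config (n + 1)) → ℝ) (σ : ℕ → Config (n + 1)) : ℝ :=
  ∑ x ∈ repPairs (k + 2),
    repWeight k x.1 * repWeight (k + 1) x.2 * (F σ * covDeriv s c (σ x.1) (σ x.2))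

theorem pathDeriv_eq (s c : ℝ) (k : ℕ) (F : (ℕ → Config (n + 1)) → ℝ) (σ : ℕ → Config (n + 1)) :
    pathDeriv s c k F σ = F σ * ∑ x ∈ Finset.range (k + 2) ×ˢ Finset.range (k + 2),
      repWeight k x.1 * repWeight (k + 1) x.2 * covDeriv s c (σ x.1) (σ x.2) := by
  have hdiag : ∀ τ : Config (n + 1), covDeriv s c τ τ = (s ^ 2 * n - c ^ 2) / 2 := fun τ => by
    simp [covDeriv, spin_mul_self]
  have h0 : ∑ x ∈ (Finset.range (k + 2)).diag,
      repWeight k x.1 * repWeight (k + 1) x.2 * covDeriv s c (σ x.1) (σ x.2) = 0 := by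
    rw [Finset.sum_diag]
    simp only [hdiag, ← Finset.sum_mul, sum_repWeight_mul_repWeight, zero_mul]
  rw [← Finset.diag_union_offDiag, Finset.sum_union (Finset.disjoint_diag_offDiag _), h0, zero_add,
    Finset.mul_sum, pathDeriv]
  exact Finset.sum_congr rfl fun x _ => by ring

theorem dependsOn_covDeriv (s c : ℝ) {a b m : ℕ} (ha : a < m) (hb : b < m) :
    DependsOn (fun σ : ℕ → Config (n + 1) => covDeriv s c (σ a) (σ b)) (Iio m) :=
  fun σ τ hst => by simp only [hst a ha, hst b hb]

theorem DependsOn.mul {S : Type*} {F G : (ℕ → S) → ℝ} {A : Set ℕ} (hF : DependsOn F A)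
    (hG : DependsOn G A) : DependsOn (fun σ => F σ * G σ) A :=
  fun σ τ hst => by simp only [hF hst, hG hst]

theorem dependsOn_mul_covDeriv (s c : ℝ) (hF : DependsOn F (Iio k)) {x : ℕ × ℕ}
    (hx : x ∈ repPairs (k + 2)) :
    DependsOn (fun σ => F σ * covDeriv s c (σ x.1) (σ x.2)) (Iio (k + 2)) := by
  simp only [Finset.mem_offDiag, Finset.mem_range] at hx
  exact DependsOn.mul (dependsOn_mono hF (Iio_subset_Iio (by omega)))
    (dependsOn_covDeriv s c hx.1 hx.2.1)

theorem dependsOn_pathDeriv (s c : ℝ) (hF : DependsOn F (Iio k)) :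
    DependsOn (pathDeriv s c k F) (Iio (k + 2)) := fun σ τ hst => by
  refine Finset.sum_congr rfl fun x hx => ?_
  have := dependsOn_mul_covDeriv s c hF hx hst
  simp only at this
  rw [this]

theorem pathMean_pathDeriv (hF : DependsOn F (Iio k)) (t : ℝ) :
    pathMean n s h c (k + 2) (pathDeriv s c k F) t =
      ∑ x ∈ repPairs (k + 2), repWeight k x.1 * repWeight (k + 1) x.2 *
        pathMean n s h c (k + 2) (fun σ => F σ * covDeriv s c (σ x.1) (σ x.2)) t := by
  unfold pathDeriv
  rw [pathMean_sum _ _ _ fun x hx => ?_]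
  · simp only [pathMean_const_mul]
  · have := dependsOn_mul_covDeriv s c hF hx
    exact fun σ τ hst => congrArg _ (this hst)

theorem hasDerivAt_pathMean (hF : DependsOn F (Iio k)) {t : ℝ} (ht : t ∈ Ioo (0 : ℝ) 1) :
    HasDerivAt (pathMean n s h c k F) (pathMean n s h c (k + 2) (pathDeriv s c k F) t) t := by
  have ht0 := ht.1
  have ht1 : 0 < 1 - t := by linarith [ht.2]
  -- within `ε` of `t`, both `u` and `1 - u` are at least `ε`, which bounds the derivatives of the
  -- square roots
  set ε := min t (1 - t) / 2 with hε
  have hε0 : 0 < ε := by positivity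
  have hball : ∀ u ∈ Metric.ball t ε, ε ≤ u ∧ ε ≤ 1 - u := fun u hu => by
    rw [Metric.mem_ball, Real.dist_eq, abs_lt] at hu
    have h1 := min_le_left t (1 - t)
    have h2 := min_le_right t (1 - t)
    constructor <;> linarith [hu.1, hu.2]
  let c' : Option (Pair (n + 1)) → ℝ → ℝ
    | none, u => -(1 / (2 * √(1 - u)))
    | some e, u => if e.1.2 = Fin.last n then 1 / (2 * √u) else 0
  have hB : ∀ u, ε ≤ u → |1 / (2 * √u)| ≤ 1 / (2 * √ε) := fun u hu => by
    rw [abs_of_nonneg (by positivity)]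
    have := Real.sqrt_le_sqrt hu
    have := Real.sqrt_pos.2 hε0
    gcongr
  have hmain := hasDerivAt_integral_avg (c := pathCoeff) (c' := c') (t := t) (B := 1 / (2 * √ε)) hε0
    (fun e u hu => ?_) (fun e u hu => ?_) (pathDir s c)
    (fun σ => h * ∑ i, spin σ i) hF
  · rw [show pathMean n s h c k F = _ from funext fun t => pathMean_eq s h c k F t]
    refine hmain.congr_deriv ?_
    rw [pathMean_eq]
    have hint : ∀ e ∈ Finset.univ, Integrable (fun x => c' e t * pathCoeff e t *
        avg (k + 2) (gibbs (linEnergy (fun e => pathCoeff e t) (pathDir s c)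
          (fun σ => h * ∑ i, spin σ i) x))
          (repDeriv (k + 1) (pathDir s c e) (repDeriv k (pathDir s c e) F)))
        (gaussianPi (Option (Pair (n + 1)))) := fun e _ => by
      obtain ⟨C, hC⟩ := exists_bound _
        (dependsOn_repDeriv (pathDir s c e) (dependsOn_repDeriv (pathDir s c e) hF))
      exact (Integrable.of_bound
        (continuous_avg_gibbs (continuous_linEnergy _ _ _) _ _).aestronglyMeasurable C
        (ae_of_all _ fun x => abs_avg_gibbs_le hC _)).const_mul _
    simp only [← integral_const_mul]
    rw [← integral_finsetSum _ hint]
    refine integral_congr_ae (ae_of_all _ fun x => ?_)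
    simp only [← avg_const_mul]
    rw [← avg_sum]
    refine avg_congr fun σ => ?_
    have hcov : ∀ σ τ : Config (n + 1), ∑ e, c' e t * pathCoeff e t *
        (pathDir s c e σ * pathDir s c e τ) = covDeriv s c σ τ := fun σ τ => by
      have e0 : c' none t * pathCoeff (n := n) none t = -(1 / 2) := by
        have := (Real.sqrt_pos.2 ht1).ne'
        simp only [c', pathCoeff]
        field_simp
      have e1 : 1 / (2 * √t) * √t = 1 / 2 := by
        have := (Real.sqrt_pos.2 ht0).ne'
        field_simp
      rw [Fintype.sum_option, e0, sum_pair_succ]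
      simp only [c', pathCoeff, (Fin.castSucc_lt_last _).ne, if_false, if_true, zero_mul,
        Finset.sum_const_zero, e1, pathDir, covDeriv, spin_init, zero_add]
      rw [Finset.mul_sum, mul_sub, Finset.mul_sum, sub_div, Finset.sum_div, sub_eq_add_neg,
        add_comm]
      congr 1
      · exact Finset.sum_congr rfl fun i _ => by ring
      · ring
    rw [pathDeriv_eq]
    simp only [repDeriv_repDeriv, ← hcov, Finset.mul_sum]
    rw [Finset.sum_comm]
    exact Finset.sum_congr rfl fun x _ => Finset.sum_congr rfl fun e _ => by ring
  · obtain ⟨h1, h2⟩ := hball u hu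
    cases e with
    | none =>
      have := ((hasDerivAt_id u).const_sub 1).sqrt (by simp only [id]; linarith)
      refine this.congr_deriv ?_
      simp only [c', id]
      ring
    | some e =>
      by_cases he : e.1.2 = Fin.last n
      · have hu0 : u ≠ 0 := (hε0.trans_le h1).ne'
        rw [show pathCoeff (some e) = fun u => √u from funext fun u => if_pos he]
        exact (Real.hasDerivAt_sqrt hu0).congr_deriv (if_pos he).symm
      · rw [show pathCoeff (some e) = fun _ => (1 : ℝ) from funext fun u => if_neg he]
        exact (hasDerivAt_const u (1 : ℝ)).congr_deriv (if_neg he).symm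
  · obtain ⟨h1, h2⟩ := hball u hu
    cases e with
    | none => simpa only [c', abs_neg] using hB _ h2
    | some e =>
      simp only [c']
      split_ifs
      · exact hB u h1
      · rw [abs_zero]; positivity

theorem hasDerivWithinAt_pathMean (s h c : ℝ) (hF : DependsOn F (Iio k)) {t : ℝ}
    (ht : t ∈ Icc (0 : ℝ) 1) :
    HasDerivWithinAt (pathMean n s h c k F) (pathMean n s h c (k + 2) (pathDeriv s c k F) t)
      (Icc 0 1) t := by
  have hc := continuous_pathMean s h c hF
  have hc' := continuous_pathMean s h c (dependsOn_pathDeriv s c hF)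
  have hd : DifferentiableOn ℝ (pathMean n s h c k F) (Ioo 0 1) := fun t ht =>
    (hasDerivAt_pathMean hF ht).differentiableAt.differentiableWithinAt
  have hderiv : ∀ l : Filter ℝ, Ioo 0 1 ∈ l → l ≤ nhds t →
      Tendsto (deriv (pathMean n s h c k F)) l
        (nhds (pathMean n s h c (k + 2) (pathDeriv s c k F) t)) := fun l hl hlt => by
    refine ((hc'.tendsto t).mono_left hlt).congr' ?_
    filter_upwards [hl] with u hu
    exact ((hasDerivAt_pathMean hF hu).deriv).symm
  rcases eq_or_lt_of_le ht.1 with h0 | h0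
  · subst h0
    have hm : Ioo (0 : ℝ) 1 ∈ nhdsWithin 0 (Ioi 0) := Ioo_mem_nhdsGT one_pos
    exact (hasDerivWithinAt_Ici_of_tendsto_deriv hd hc.continuousWithinAt hm
      (hderiv _ hm nhdsWithin_le_nhds)).mono Icc_subset_Ici_self
  rcases eq_or_lt_of_le ht.2 with h1 | h1
  · subst h1
    have hm : Ioo (0 : ℝ) 1 ∈ nhdsWithin 1 (Iio 1) := Ioo_mem_nhdsLT one_pos
    exact (hasDerivWithinAt_Iic_of_tendsto_deriv hd hc.continuousWithinAt hm
      (hderiv _ hm nhdsWithin_le_nhds)).mono Icc_subset_Iic_self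
  · exact (hasDerivAt_pathMean hF ⟨h0, h1⟩).hasDerivWithinAt

theorem derivWithin_pathMean (s h c : ℝ) (hF : DependsOn F (Iio k)) {t : ℝ}
    (ht : t ∈ Icc (0 : ℝ) 1) :
    derivWithin (pathMean n s h c k F) (Icc 0 1) t =
      pathMean n s h c (k + 2) (pathDeriv s c k F) t :=
  (hasDerivWithinAt_pathMean s h c hF ht).derivWithin (uniqueDiffOn_Icc one_pos t ht)

theorem contDiffOn_pathMean (s h c : ℝ) (hF : DependsOn F (Iio k)) :
    ContDiffOn ℝ ∞ (pathMean n s h c k F) (Icc 0 1) := by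
  refine contDiffOn_infty.2 fun m => ?_
  induction m generalizing k F with
  | zero => exact contDiffOn_zero.2 (continuous_pathMean s h c hF).continuousOn
  | succ m ih =>
    rw [Nat.cast_succ, contDiffOn_succ_iff_derivWithin (uniqueDiffOn_Icc one_pos)]
    refine ⟨fun t ht => (hasDerivWithinAt_pathMean s h c hF ht).differentiableWithinAt,
      fun hm => ?_, (ih (dependsOn_pathDeriv s c hF)).congr fun t ht =>
        derivWithin_pathMean s h c hF ht⟩
    simp at hm

/-- The derivative of order `l` at `t` of the mean of `F` along the smart path. -/
def pathMeanDeriv (n : ℕ) (s h c : ℝ) (l k : ℕ) (F : (ℕ → Config (n + 1)) → ℝ) (t : ℝ) : ℝ :=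
  iteratedDerivWithin l (pathMean n s h c k F) (Icc 0 1) t

theorem pathMeanDeriv_zero (t : ℝ) : pathMeanDeriv n s h c 0 k F t = pathMean n s h c k F t := by
  simp [pathMeanDeriv]

/-- Differentiation lowers the order by one and adds two replicas. -/
theorem pathMeanDeriv_succ (l : ℕ) (hF : DependsOn F (Iio k)) {t : ℝ} (ht : t ∈ Icc (0 : ℝ) 1) :
    pathMeanDeriv n s h c (l + 1) k F t = ∑ x ∈ repPairs (k + 2),
      repWeight k x.1 * repWeight (k + 1) x.2 *
        pathMeanDeriv n s h c l (k + 2) (fun σ => F σ * covDeriv s c (σ x.1) (σ x.2)) t := by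
  unfold pathMeanDeriv
  have h1 : ∀ x ∈ repPairs (k + 2), ContDiffWithinAt ℝ l
      (pathMean n s h c (k + 2) fun σ => F σ * covDeriv s c (σ x.1) (σ x.2)) (Icc 0 1) t :=
    fun x hx => ((contDiffOn_pathMean s h c (dependsOn_mul_covDeriv s c hF hx)).of_le
      (by exact_mod_cast le_top)).contDiffWithinAt ht
  rw [iteratedDerivWithin_succ', iteratedDerivWithin_congr (g := fun t => ∑ x ∈ repPairs (k + 2),
      repWeight k x.1 * repWeight (k + 1) x.2 * pathMean n s h c (k + 2)
        (fun σ => F σ * covDeriv s c (σ x.1) (σ x.2)) t) (fun u hu => ?_) ht,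
    iteratedDerivWithin_fun_sum]
  · refine Finset.sum_congr rfl fun x hx => ?_
    rw [iteratedDerivWithin_const_mul ht (uniqueDiffOn_Icc one_pos) _ (h1 x hx)]
  · exact ht
  · exact uniqueDiffOn_Icc one_pos
  · exact fun x hx => contDiffWithinAt_const.mul (h1 x hx)
  · simp only [derivWithin_pathMean s h c hF hu, pathMean_pathDeriv hF]

end Path

/-! ### Endpoints of the path and symmetry between sites -/

section Product

variable {S T U : Type*} [Inhabited S] [Fintype S] [Inhabited T] [Fintype T] [Inhabited U]
  [Fintype U]

/-- If the replicas live in a product space and the weights are product weights, then averages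
of products factorise. -/
theorem avg_mul_of_equiv (Φ : S ≃ T × U) (hΦ : Φ default = default) {w : S → ℝ} {w₁ : T → ℝ}
    {w₂ : U → ℝ} (hw : ∀ s, w s = w₁ (Φ s).1 * w₂ (Φ s).2) (k : ℕ) (F : (ℕ → T) → ℝ)
    (G : (ℕ → U) → ℝ) :
    avg k w (fun σ => F (fun r => (Φ (σ r)).1) * G fun r => (Φ (σ r)).2) =
      avg k w₁ F * avg k w₂ G := by
  unfold avg
  rw [Finset.sum_mul_sum, ← Fintype.sum_prod_type',
    ← ((Equiv.arrowCongr (Equiv.refl (Fin k)) Φ).trans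
      (Equiv.arrowProdEquivProdArrow _ _ _)).sum_comp]
  refine Finset.sum_congr rfl fun σ _ => ?_
  have h1 : (fun r => (Φ (toSeq σ r)).1) = toSeq fun r : Fin k => (Φ (σ r)).1 := by
    funext r; simp only [toSeq]; split_ifs; exacts [rfl, by rw [hΦ]; rfl]
  have h2 : (fun r => (Φ (toSeq σ r)).2) = toSeq fun r : Fin k => (Φ (σ r)).2 := by
    funext r; simp only [toSeq]; split_ifs; exacts [rfl, by rw [hΦ]; rfl]
  simp only [h1, h2, hw, Finset.prod_mul_distrib]
  change _ = (∏ r, w₁ (Φ (σ r)).1) * F (toSeq fun r => (Φ (σ r)).1) *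
    ((∏ r, w₂ (Φ (σ r)).2) * G (toSeq fun r => (Φ (σ r)).2))
  ring

theorem avg_comp_equiv (Φ : S ≃ T) (hΦ : Φ default = default) (w : T → ℝ) (k : ℕ)
    (F : (ℕ → T) → ℝ) :
    avg k (fun s => w (Φ s)) (fun σ => F fun r => Φ (σ r)) = avg k w F := by
  unfold avg
  rw [← (Equiv.arrowCongr (Equiv.refl (Fin k)) Φ).sum_comp]
  refine Finset.sum_congr rfl fun σ _ => ?_
  have h1 : (fun r => Φ (toSeq σ r)) = toSeq fun r : Fin k => Φ (σ r) := by
    funext r; simp only [toSeq]; split_ifs <;> simp [hΦ]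
  simp only [h1]
  rfl

end Product

section Endpoints

variable {n : ℕ}

/-- The law of the last spin at `t = 0`, when it feels only the field `x`. -/
def lastWeight (x : ℝ) (ε : ℤˣ) : ℝ :=
  Real.exp (((ε : ℤ) : ℝ) * x) / ∑ ε' : ℤˣ, Real.exp (((ε' : ℤ) : ℝ) * x)

theorem sum_exp_unit_pos (x : ℝ) : 0 < ∑ ε : ℤˣ, Real.exp (((ε : ℤ) : ℝ) * x) :=
  Finset.sum_pos (fun _ _ => Real.exp_pos _) Finset.univ_nonempty

theorem sum_lastWeight (x : ℝ) : ∑ ε, lastWeight x ε = 1 := by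
  simp only [lastWeight, ← Finset.sum_div]
  exact div_self (sum_exp_unit_pos x).ne'

theorem lastWeight_nonneg (x : ℝ) (ε : ℤˣ) : 0 ≤ lastWeight x ε :=
  div_nonneg (Real.exp_pos _).le (sum_exp_unit_pos x).le

theorem avg_lastWeight_spin (x : ℝ) :
    ∑ ε, lastWeight x ε * ((ε : ℤ) : ℝ) = Real.tanh x := by
  have h : ∀ f : ℤˣ → ℝ, ∑ ε, f ε = f 1 + f (-1) := fun f => by
    rw [show (Finset.univ : Finset ℤˣ) = {1, -1} from rfl, Finset.sum_pair (by decide)]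
  rw [h]
  simp only [lastWeight, h, Real.tanh_eq_sinh_div_cosh, Real.sinh_eq, Real.cosh_eq]
  have h1 := Real.exp_pos x
  have h2 := Real.exp_pos (-x)
  simp
  field_simp
  ring

/-- The last spin and the configuration of the others. -/
def splitLast (n : ℕ) : Config (n + 1) ≃ ℤˣ × Config n := (Fin.snocEquiv fun _ => ℤˣ).symm

theorem splitLast_apply (σ : Config (n + 1)) : splitLast n σ = (σ (Fin.last n), init σ) := rfl

theorem gibbs_pathEnergy_zero (s h c : ℝ) (g : Couplings (n + 1)) (z : ℝ) (σ : Config (n + 1)) :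
    gibbs (pathEnergy s h c 0 g z) σ = lastWeight (c * z + h) (splitLast n σ).1 *
      gibbs (sysEnergy s h (initCouplings g)) (splitLast n σ).2 := by
  have hE : ∀ τ : Config (n + 1), Real.exp (pathEnergy s h c 0 g z τ) =
      Real.exp ((((splitLast n τ).1 : ℤ) : ℝ) * (c * z + h)) *
        Real.exp (sysEnergy s h (initCouplings g) (splitLast n τ).2) := fun τ => by
    rw [← Real.exp_add]
    congr 1
    simp only [pathEnergy, splitLast_apply, spin, Real.sqrt_zero, zero_mul, sub_zero,
      Real.sqrt_one, one_mul, zero_add]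
    ring
  have hZ : ∑ τ : Config (n + 1), Real.exp (pathEnergy s h c 0 g z τ) =
      (∑ ε : ℤˣ, Real.exp (((ε : ℤ) : ℝ) * (c * z + h))) *
        ∑ ρ : Config n, Real.exp (sysEnergy s h (initCouplings g) ρ) := by
    simp only [hE]
    rw [Finset.sum_mul_sum, ← Fintype.sum_prod_type']
    exact (splitLast n).sum_comp fun x => Real.exp (((x.1 : ℤ) : ℝ) * (c * z + h)) *
      Real.exp (sysEnergy s h (initCouplings g) x.2)
  rw [gibbs, hZ, hE, lastWeight, gibbs, mul_div_mul_comm]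

/-- The mean of a function of the last spins of the replicas at `t = 0`. -/
def lastMean (h c : ℝ) (k : ℕ) (f : (ℕ → ℤˣ) → ℝ) : ℝ :=
  ∫ z, avg k (lastWeight (c * z + h)) f ∂gaussianReal 0 1

theorem measurePreserving_initCouplings :
    MeasurePreserving (initCouplings (n := n)) (couplingLaw (n + 1)) (couplingLaw n) :=
  measurePreserving_comp_injective (f := fun e : Pair n => (⟨(e.1.1.castSucc, e.1.2.castSucc),
    Fin.castSucc_lt_castSucc_iff.2 e.2⟩ : Pair (n + 1))) fun e e' hee => by
      obtain ⟨⟨i, j⟩, he⟩ := e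
      obtain ⟨⟨i', j'⟩, he'⟩ := e'
      simpa using hee

/-- At `t = 0` the last spin is independent of the others. -/
theorem pathMean_zero (s h c : ℝ) (k : ℕ) (f : (ℕ → ℤˣ) → ℝ) (G : (ℕ → Config n) → ℝ) :
    pathMean n s h c k (fun σ => f (fun r => σ r (Fin.last n)) * G fun r => init (σ r)) 0 =
      lastMean h c k f * sysMean n s h k G := by
  have h1 : ∀ x : Couplings (n + 1) × ℝ, avg k (gibbs (pathEnergy s h c 0 x.1 x.2))
      (fun σ => f (fun r => σ r (Fin.last n)) * G fun r => init (σ r)) =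
      avg k (gibbs (sysEnergy s h (initCouplings x.1))) G * avg k (lastWeight (c * x.2 + h)) f :=
    fun x => by
      rw [mul_comm]
      exact avg_mul_of_equiv (splitLast n) rfl (gibbs_pathEnergy_zero s h c x.1 x.2) k f G
  have hp := measurePreserving_initCouplings (n := n)
  simp only [pathMean, h1]
  rw [integral_prod_mul (fun g => avg k (gibbs (sysEnergy s h (initCouplings g))) G)
    (fun z => avg k (lastWeight (c * z + h)) f), mul_comm, sysMean, ← hp.map_eq,
    integral_map hp.measurable.aemeasurable
      (continuous_avg_gibbs (continuous_sysEnergy s h) k G).aestronglyMeasurable]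
  rfl

/-- At `t = 1` the smart path reaches the system of `n + 1` sites. -/
theorem pathMean_one (s h c : ℝ) (k : ℕ) (F : (ℕ → Config (n + 1)) → ℝ) :
    pathMean n s h c k F 1 = sysMean (n + 1) s h k F := by
  have h1 : ∀ (g : Couplings (n + 1)) z, pathEnergy s h c 1 g z = sysEnergy s h g :=
    fun g z => by
      funext σ
      simp only [pathEnergy, sysEnergy, sum_pair_succ, Fin.sum_univ_castSucc, Real.sqrt_one,
        sub_self, Real.sqrt_zero, spin_init, initCouplings]
      rw [mul_add, mul_add, mul_add, mul_add, one_mul, zero_mul, mul_zero, add_zero, ← mul_assoc,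
        mul_comm (spin σ (Fin.last n)) s, mul_assoc, Finset.mul_sum Finset.univ _
        (spin σ (Fin.last n)), Finset.sum_congr rfl fun i _ => mul_comm (spin σ (Fin.last n)) _]
      ring
  have h2 := integral_prod_mul (μ := couplingLaw (n + 1)) (ν := gaussianReal 0 1)
    (fun g => avg k (gibbs (sysEnergy s h g)) F) (fun _ => (1 : ℝ))
  simp only [mul_one, integral_const, probReal_univ, smul_eq_mul] at h2
  simp only [pathMean, sysMean, h1]
  exact h2

end Endpoints

section Symmetry

variable {n : ℕ}

/-- The action of a permutation of the sites on unordered pairs of sites. -/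
def permPairFun (π : Equiv.Perm (Fin n)) (e : Pair n) : Pair n :=
  if h : π e.1.1 < π e.1.2 then ⟨(π e.1.1, π e.1.2), h⟩
  else ⟨(π e.1.2, π e.1.1), lt_of_le_of_ne (not_lt.1 h) fun h' => e.2.ne (π.injective h'.symm)⟩

theorem permPairFun_inv (π : Equiv.Perm (Fin n)) (e : Pair n) :
    permPairFun π⁻¹ (permPairFun π e) = e := by
  obtain ⟨⟨i, j⟩, he⟩ := e
  have he' : i < j := he
  unfold permPairFun
  by_cases h : π i < π j
  · simp [h, he']
  · simp [h, he'.asymm]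

theorem permPairFun_injective (π : Equiv.Perm (Fin n)) : Function.Injective (permPairFun π) :=
  Function.LeftInverse.injective (permPairFun_inv π)

theorem permPairFun_symm (π : Equiv.Perm (Fin n)) (u : Fin n → Fin n → ℝ)
    (hu : ∀ i j, u i j = u j i) (e : Pair n) :
    u (permPairFun π e).1.1 (permPairFun π e).1.2 = u (π e.1.1) (π e.1.2) := by
  unfold permPairFun
  split_ifs
  · rfl
  · exact hu _ _

theorem sysEnergy_comp_perm (s h : ℝ) (π : Equiv.Perm (Fin n)) (g : Couplings n) (σ : Config n) :
    sysEnergy s h g (σ ∘ π) = sysEnergy s h (g ∘ permPairFun π⁻¹) σ := by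
  unfold sysEnergy
  congr 2
  · have hb : Function.Bijective (permPairFun π) :=
      (permPairFun_injective π).bijective_of_finite
    rw [← (Equiv.ofBijective _ hb).sum_comp fun e =>
      (g ∘ permPairFun π⁻¹) e * spin σ e.1.1 * spin σ e.1.2]
    refine Finset.sum_congr rfl fun e _ => ?_
    simp only [Equiv.ofBijective_apply, Function.comp_apply, permPairFun_inv, mul_assoc]
    congr 1
    exact (permPairFun_symm π (fun i j => spin σ i * spin σ j) (fun i j => mul_comm _ _) e).symm
  · exact Equiv.sum_comp π fun i => spin σ i

/-- The sites play the same role: means are invariant under permutations of the sites. -/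
theorem sysMean_perm (s h : ℝ) (π : Equiv.Perm (Fin n)) (k : ℕ) (F : (ℕ → Config n) → ℝ) :
    sysMean n s h k (fun σ => F fun r => σ r ∘ π) = sysMean n s h k F := by
  have hp := measurePreserving_comp_injective (permPairFun_injective π⁻¹)
  have hp' : MeasurePreserving (fun g : Couplings n => g ∘ permPairFun π⁻¹) (couplingLaw n)
    (couplingLaw n) := hp
  unfold sysMean
  conv_lhs => rw [← hp'.map_eq]
  rw [integral_map hp'.measurable.aemeasurable
    (continuous_avg_gibbs (continuous_sysEnergy s h) _ _).aestronglyMeasurable]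
  refine integral_congr_ae (ae_of_all _ fun g => ?_)
  let Φ : Config n ≃ Config n := Equiv.arrowCongr π.symm (Equiv.refl _)
  have hΦ : ∀ σ, Φ σ = σ ∘ π := fun σ => rfl
  have hg : gibbs (sysEnergy s h (g ∘ permPairFun π⁻¹)) =
      fun σ => gibbs (sysEnergy s h g) (Φ σ) := by
    funext σ
    simp only [gibbs, hΦ, sysEnergy_comp_perm]
    congr 1
    rw [← Φ.sum_comp fun τ => Real.exp (sysEnergy s h g τ)]
    simp only [hΦ, sysEnergy_comp_perm]
  simp only [hg]
  exact avg_comp_equiv Φ rfl (gibbs (sysEnergy s h g)) k F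

end Symmetry

/-! ### Control of means at high temperature -/

/-- The parameters for which the estimates below are uniform: `β ≤ 1/20`, `q` is an overlap
parameter, the couplings have variance `β² / N`, and the smart path is that of a system with
`n + 1` sites, where `n + 1` is `N` or `N - 1`. -/
structure IsAdmissible (h β q : ℝ) (N n : ℕ) : Prop where
  nonneg : 0 ≤ β
  le : β ≤ 1 / 20
  isOverlapParameter : IsOverlapParameter β h q
  le_size : n + 1 ≤ N
  size_le : N ≤ n + 2

/-- `pathMean` at inverse temperature `β`, the couplings having variance `β² / N`. -/
abbrev cavMean (N n : ℕ) (β h q : ℝ) (k : ℕ) (F : (ℕ → Config (n + 1)) → ℝ) (t : ℝ) : ℝ :=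
  pathMean n (β / √(N : ℝ)) h (β * √q) k F t

/-- The deviation `R⁻ - q`, where `R⁻` is the part of the overlap that does not involve the last
site. -/
abbrev cavDev (N : ℕ) (q : ℝ) {n : ℕ} (σ τ : Config (n + 1)) : ℝ :=
  overlapDev N q (init σ) (init τ)

/-- The product of the last spins of two configurations. -/
abbrev lastProd {n : ℕ} (σ τ : Config (n + 1)) : ℝ := spin σ (Fin.last n) * spin τ (Fin.last n)

theorem tanh_sq_le_one (x : ℝ) : Real.tanh x ^ 2 ≤ 1 := by
  nlinarith [Real.tanh_lt_one x, Real.neg_one_lt_tanh x]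

theorem IsOverlapParameter.nonneg {β h q : ℝ} (hq : IsOverlapParameter β h q) : 0 ≤ q := by
  rw [← hq]
  exact integral_nonneg fun z => sq_nonneg _

theorem IsOverlapParameter.le_one {β h q : ℝ} (hq : IsOverlapParameter β h q) : q ≤ 1 := by
  rw [← hq]
  refine (integral_mono_of_nonneg (ae_of_all _ fun z => sq_nonneg _)
    (integrable_const (1 : ℝ)) (ae_of_all _ fun z => tanh_sq_le_one _)).trans_eq (by simp)

theorem abs_lastProd {n : ℕ} (σ τ : Config (n + 1)) : |lastProd σ τ| = 1 := by
  rw [abs_mul, abs_spin, abs_spin, one_mul]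

theorem abs_overlapDev_le {N m : ℕ} (hm : m ≤ N) (hN : 0 < N) {q : ℝ} (h0 : 0 ≤ q) (h1 : q ≤ 1)
    (σ τ : Config m) : |overlapDev N q σ τ| ≤ 2 := by
  have hN' : (0 : ℝ) < N := by exact_mod_cast hN
  have hs : |∑ i, spin σ i * spin τ i| ≤ m := by
    refine (Finset.abs_sum_le_sum_abs _ _).trans ?_
    simp [abs_mul, abs_spin]
  have hd : |(∑ i, spin σ i * spin τ i) / N| ≤ 1 := by
    rw [abs_div, abs_of_pos hN', div_le_one hN']
    exact hs.trans (by exact_mod_cast hm)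
  unfold overlapDev
  rw [abs_le] at hd ⊢
  constructor <;> linarith [hd.1, hd.2]

theorem overlapDev_eq_cavDev {N n : ℕ} {q : ℝ} (σ τ : Config (n + 1)) :
    overlapDev N q σ τ = cavDev N q σ τ + lastProd σ τ / N := by
  simp only [overlapDev, cavDev, lastProd, Fin.sum_univ_castSucc, spin_init]
  ring

theorem dependsOn_pair {S : Type*} (u : S → S → ℝ) {a b k : ℕ} (ha : a < k) (hb : b < k) :
    DependsOn (fun σ : ℕ → S => u (σ a) (σ b)) (Iio k) :=
  fun σ τ hst => by simp only [hst a ha, hst b hb]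

theorem covDeriv_eq {N n : ℕ} {β q : ℝ} (hq : 0 ≤ q) (σ τ : Config (n + 1)) :
    covDeriv (β / √(N : ℝ)) (β * √q) σ τ = β ^ 2 / 2 * (lastProd σ τ * cavDev N q σ τ) := by
  simp only [covDeriv, lastProd, cavDev, overlapDev, div_pow, mul_pow, Real.sq_sqrt hq,
    Real.sq_sqrt (Nat.cast_nonneg N)]
  ring

theorem abs_covDeriv_eq {N n : ℕ} {β q : ℝ} (hq : 0 ≤ q) (σ τ : Config (n + 1)) :
    |covDeriv (β / √(N : ℝ)) (β * √q) σ τ| = β ^ 2 / 2 * |cavDev N q σ τ| := by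
  rw [covDeriv_eq hq, abs_mul, abs_mul, abs_lastProd, one_mul, abs_of_nonneg (by positivity)]

namespace IsAdmissible

variable {h β q : ℝ} {N n : ℕ}

theorem pos (H : IsAdmissible h β q N n) : 0 < N := lt_of_lt_of_le n.succ_pos H.le_size

theorem one_le_cast (H : IsAdmissible h β q N n) : (1 : ℝ) ≤ N := by exact_mod_cast H.pos

theorem sq_le (H : IsAdmissible h β q N n) : β ^ 2 ≤ 1 / 400 := by
  nlinarith [H.nonneg, H.le]

theorem abs_cavDev_le (H : IsAdmissible h β q N n) (σ τ : Config (n + 1)) :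
    |cavDev N q σ τ| ≤ 2 :=
  abs_overlapDev_le ((Nat.le_succ n).trans H.le_size) H.pos H.isOverlapParameter.nonneg
    H.isOverlapParameter.le_one _ _

theorem abs_dev_le (H : IsAdmissible h β q N n) (σ τ : Config (n + 1)) :
    |overlapDev N q σ τ| ≤ 2 :=
  abs_overlapDev_le H.le_size H.pos H.isOverlapParameter.nonneg H.isOverlapParameter.le_one _ _

end IsAdmissible

/-- The total weight of the pairs of distinct replicas in the derivative of a mean. -/
def totalWeight (k : ℕ) : ℝ := ∑ x ∈ repPairs (k + 2), |repWeight k x.1 * repWeight (k + 1) x.2|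

theorem totalWeight_nonneg (k : ℕ) : 0 ≤ totalWeight k := Finset.sum_nonneg fun _ _ => abs_nonneg _

theorem totalWeight_two : totalWeight 2 = 20 := by
  have : repPairs (2 + 2) = {(0, 1), (0, 2), (0, 3), (1, 0), (1, 2), (1, 3), (2, 0), (2, 1),
    (2, 3), (3, 0), (3, 1), (3, 2)} := by decide
  rw [totalWeight, this]
  norm_num [repWeight]

theorem abs_pathMean_pathDeriv_le {n k : ℕ} {s h c : ℝ} {F : (ℕ → Config (n + 1)) → ℝ}
    (hF : DependsOn F (Iio k)) {t B : ℝ}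
    (hB : ∀ a b, a ≠ b → a < k + 2 → b < k + 2 →
      |pathMean n s h c (k + 2) (fun σ => F σ * covDeriv s c (σ a) (σ b)) t| ≤ B) :
    |pathMean n s h c (k + 2) (pathDeriv s c k F) t| ≤ totalWeight k * B := by
  rw [pathMean_pathDeriv hF, totalWeight, Finset.sum_mul]
  refine (Finset.abs_sum_le_sum_abs _ _).trans (Finset.sum_le_sum fun x hx => ?_)
  simp only [Finset.mem_offDiag, Finset.mem_range] at hx
  rw [abs_mul]
  exact mul_le_mul_of_nonneg_left (hB _ _ hx.2.2 hx.1 hx.2.1) (abs_nonneg _)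

theorem pathMean_nonneg {n k : ℕ} {s h c : ℝ} {F : (ℕ → Config (n + 1)) → ℝ} (t : ℝ)
    (hF : DependsOn F (Iio k)) (h0 : ∀ σ, 0 ≤ F σ) : 0 ≤ pathMean n s h c k F t := by
  rw [← pathMean_const (n := n) (s := s) (h := h) (c := c) (k := k) 0 t]
  exact pathMean_mono t (fun _ _ _ => rfl) hF h0

/-- At high temperature the mean of a nonnegative function of two replicas is, all along the smart
path, at most twice its value at `t = 1`. -/
theorem cavMean_le_two_mul {h β q : ℝ} {N n : ℕ} (H : IsAdmissible h β q N n)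
    {F : (ℕ → Config (n + 1)) → ℝ} (hF : DependsOn F (Iio 2)) (h0 : ∀ σ, 0 ≤ F σ) {t : ℝ}
    (ht : t ∈ Icc (0 : ℝ) 1) : cavMean N n β h q 2 F t ≤ 2 * cavMean N n β h q 2 F 1 := by
  set ψ := cavMean N n β h q 2 F with hψ
  have hq := H.isOverlapParameter.nonneg
  have hpos : ∀ u, 0 ≤ ψ u := fun u => pathMean_nonneg u hF h0
  have hd : ∀ u, |cavMean N n β h q 4 (pathDeriv (β / √(N : ℝ)) (β * √q) 2 F) u| ≤ ψ u / 20 :=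
    fun u => by
      refine (abs_pathMean_pathDeriv_le hF (B := 1 / 400 * ψ u) fun a b _ ha hb => ?_).trans
        (by rw [totalWeight_two]; linarith)
      have hdep : DependsOn (fun σ : ℕ → Config (n + 1) =>
          F σ * covDeriv (β / √(N : ℝ)) (β * √q) (σ a) (σ b)) (Iio (2 + 2)) :=
        DependsOn.mul (dependsOn_mono hF (Iio_subset_Iio (by omega))) (dependsOn_covDeriv _ _ ha hb)
      refine (abs_pathMean_le u hdep).trans ?_
      rw [hψ, cavMean, ← pathMean_of_dependsOn hF (show 2 ≤ 2 + 2 by omega) u,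
        ← pathMean_const_mul]
      refine pathMean_mono u (fun σ τ hst => congrArg _ (hdep hst)) (fun σ τ hst => congrArg _
        (dependsOn_mono hF (Iio_subset_Iio (by omega : 2 ≤ 2 + 2)) hst)) fun σ => ?_
      rw [abs_mul, abs_of_nonneg (h0 σ), abs_covDeriv_eq hq, mul_comm]
      refine mul_le_mul_of_nonneg_right ?_ (h0 σ)
      have h1 := H.abs_cavDev_le (σ a) (σ b)
      have h2 := H.sq_le
      nlinarith [abs_nonneg (cavDev N q (σ a) (σ b))]
  -- the factor `1 + u` compensates for a logarithmic derivative of at most `1 / 20`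
  have hmono : MonotoneOn (fun u => (1 + u) * ψ u) (Icc 0 1) := by
    have hder : ∀ u ∈ Ioo (0 : ℝ) 1, HasDerivAt (fun u => (1 + u) * ψ u)
        (1 * ψ u + (1 + u) * cavMean N n β h q 4 (pathDeriv (β / √(N : ℝ)) (β * √q) 2 F) u) u :=
      fun u hu => ((hasDerivAt_id u).const_add 1).mul (hasDerivAt_pathMean hF hu)
    refine monotoneOn_of_deriv_nonneg (convex_Icc 0 1)
      ((continuous_const.add continuous_id).mul (continuous_pathMean _ _ _ hF)).continuousOn ?_ ?_
    · rw [interior_Icc]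
      exact fun u hu => (hder u hu).differentiableAt.differentiableWithinAt
    · rw [interior_Icc]
      intro u hu
      rw [(hder u hu).deriv]
      have h1 := (abs_le.1 (hd u)).1
      nlinarith [hpos u, hu.1, hu.2]
  have := hmono ht (right_mem_Icc.2 zero_le_one) ht.2
  simp only at this
  nlinarith [hpos t, ht.1]

theorem lastMean_pair {h β q : ℝ} (hq : IsOverlapParameter β h q) :
    lastMean h (β * √q) 2 (fun ε => ((ε 0 : ℤ) : ℝ) * ((ε 1 : ℤ) : ℝ) - q) = 0 := by
  have h1 : ∀ x, avg 2 (lastWeight x) (fun ε => ((ε 0 : ℤ) : ℝ) * ((ε 1 : ℤ) : ℝ) - q) =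
      Real.tanh x ^ 2 - q := fun x => by
    rw [avg_sub, avg_const (sum_lastWeight x)]
    congr 1
    rw [avg_succ, sq]
    conv_rhs => rw [← avg_lastWeight_spin x]
    rw [Finset.sum_mul]
    refine Finset.sum_congr rfl fun a _ => ?_
    rw [avg_succ, Finset.mul_sum, Finset.mul_sum]
    refine Finset.sum_congr rfl fun b _ => ?_
    simp [avg]
    ring
  simp only [lastMean, h1]
  rw [integral_sub ?_ (integrable_const q)]
  · have h2 : ∀ z, β * √q * z + h = β * z * √q + h := fun z => by ring
    have h3 : ∫ z, Real.tanh (β * z * √q + h) ^ 2 ∂gaussianReal 0 1 = q := hq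
    simp only [h2, h3]
    simp
  · refine Integrable.of_bound (Continuous.aestronglyMeasurable ?_) 1 (ae_of_all _ fun z => ?_)
    · have ht : Continuous Real.tanh := by
        rw [show Real.tanh = fun x => Real.sinh x / Real.cosh x from
          funext Real.tanh_eq_sinh_div_cosh]
        exact Real.continuous_sinh.div Real.continuous_cosh fun x => (Real.cosh_pos x).ne'
      fun_prop
    · rw [Real.norm_of_nonneg (sq_nonneg _)]
      exact tanh_sq_le_one _

/-- The product of the last spins minus `q`, times an odd power of `R⁻ - q`: this mean vanishes at
`t = 0` by the choice of `q`, and the derivative along the path is bounded by `β²` times the next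
even moment of `R⁻ - q`. -/
theorem abs_cavMean_centred_le {h β q : ℝ} {N n : ℕ} (H : IsAdmissible h β q N n) (m : ℕ) :
    |cavMean N n β h q 2 (fun σ => (lastProd (σ 0) (σ 1) - q) *
      cavDev N q (σ 0) (σ 1) ^ (2 * m + 1)) 1| ≤
      cavMean N n β h q 2 (fun σ => cavDev N q (σ 0) (σ 1) ^ (2 * m + 2)) 1 / 5 := by
  have hq := H.isOverlapParameter
  set Y := cavMean N n β h q 2 (fun σ => cavDev N q (σ 0) (σ 1) ^ (2 * m + 2)) 1 with hY
  set F : (ℕ → Config (n + 1)) → ℝ := fun σ => (lastProd (σ 0) (σ 1) - q) *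
      cavDev N q (σ 0) (σ 1) ^ (2 * m + 1) with hFdef
  have hF : DependsOn F (Iio 2) := dependsOn_pair (fun σ τ => (lastProd σ τ - q) *
      cavDev N q σ τ ^ (2 * m + 1)) (by norm_num) (by norm_num)
  have h0 : cavMean N n β h q 2 F 0 = 0 := by
    have := pathMean_zero (n := n) (β / √(N : ℝ)) h (β * √q) 2
      (fun ε => ((ε 0 : ℤ) : ℝ) * ((ε 1 : ℤ) : ℝ) - q)
      (fun ρ => overlapDev N q (ρ 0) (ρ 1) ^ (2 * m + 1))
    rw [lastMean_pair hq, zero_mul] at this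
    exact this
  have hpair : ∀ a b, a ≠ b → a < 4 → b < 4 → ∀ u ∈ Icc (0 : ℝ) 1,
      cavMean N n β h q 4 (fun σ => cavDev N q (σ a) (σ b) ^ (2 * m + 2)) u ≤ 2 * Y :=
    fun a b hab ha hb u hu => by
      rw [cavMean, pathMean_pair (fun σ τ => cavDev N q σ τ ^ (2 * m + 2)) hab ha hb]
      exact cavMean_le_two_mul H (dependsOn_pair (fun σ τ => cavDev N q σ τ ^ (2 * m + 2))
        (by norm_num) (by norm_num)) (fun σ => by
          rw [show 2 * m + 2 = 2 * (m + 1) by ring]; exact (even_two_mul _).pow_nonneg _) hu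
  have hd : ∀ u ∈ Icc (0 : ℝ) 1,
      ‖cavMean N n β h q 4 (pathDeriv (β / √(N : ℝ)) (β * √q) 2 F) u‖ ≤ Y / 5 := fun u hu => by
    refine (abs_pathMean_pathDeriv_le hF (B := Y / 100) fun a b hab ha hb => ?_).trans
        (by rw [totalWeight_two]; linarith)
    have hdep : DependsOn (fun σ : ℕ → Config (n + 1) =>
        F σ * covDeriv (β / √(N : ℝ)) (β * √q) (σ a) (σ b)) (Iio (2 + 2)) :=
      DependsOn.mul (dependsOn_mono hF (Iio_subset_Iio (by omega))) (dependsOn_covDeriv _ _ ha hb)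
    have d1 : DependsOn (fun σ : ℕ → Config (n + 1) => cavDev N q (σ 0) (σ 1) ^ (2 * m + 2))
      (Iio 4) :=
        dependsOn_pair (fun σ τ => cavDev N q σ τ ^ (2 * m + 2)) (by norm_num) (by norm_num)
    have d2 : DependsOn (fun σ : ℕ → Config (n + 1) => cavDev N q (σ a) (σ b) ^ (2 * m + 2))
      (Iio 4) := dependsOn_pair (fun σ τ => cavDev N q σ τ ^ (2 * m + 2)) ha hb
    have d3 : DependsOn (fun σ : ℕ → Config (n + 1) => cavDev N q (σ 0) (σ 1) ^ (2 * m + 2) +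
        cavDev N q (σ a) (σ b) ^ (2 * m + 2)) (Iio 4) := fun σ τ hst => by
      have := d1 hst; have := d2 hst; simp_all
    refine (abs_pathMean_le u hdep).trans ?_
    have hle : pathMean n (β / √(N : ℝ)) h (β * √q) 4
        (fun σ => |F σ * covDeriv (β / √(N : ℝ)) (β * √q) (σ a) (σ b)|) u ≤
        β ^ 2 * (pathMean n (β / √(N : ℝ)) h (β * √q) 4
          (fun σ => cavDev N q (σ 0) (σ 1) ^ (2 * m + 2)) u +
        pathMean n (β / √(N : ℝ)) h (β * √q) 4
          (fun σ => cavDev N q (σ a) (σ b) ^ (2 * m + 2)) u) := by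
      rw [← pathMean_add u d1 d2, ← pathMean_const_mul]
      refine pathMean_mono u (fun σ τ hst => congrArg _ (hdep hst))
        (fun σ τ hst => congrArg _ (d3 hst)) fun σ => ?_
      rw [abs_mul, hFdef, abs_covDeriv_eq hq.nonneg, abs_mul, abs_pow]
      have e1 : |lastProd (σ 0) (σ 1) - q| ≤ 2 := by
        have := abs_le.1 (abs_lastProd (σ 0) (σ 1)).le
        rw [abs_le]
        constructor <;> linarith [hq.nonneg, hq.le_one, this.1, this.2]
      set x := |cavDev N q (σ 0) (σ 1)| with hx
      set y := |cavDev N q (σ a) (σ b)| with hy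
      have hx0 : 0 ≤ x := abs_nonneg _
      have hy0 : 0 ≤ y := abs_nonneg _
      have ex : cavDev N q (σ 0) (σ 1) ^ (2 * m + 2) = x ^ (2 * m + 2) := by
        rw [hx, show 2 * m + 2 = 2 * (m + 1) by ring, (even_two_mul _).pow_abs]
      have ey : cavDev N q (σ a) (σ b) ^ (2 * m + 2) = y ^ (2 * m + 2) := by
        rw [hy, show 2 * m + 2 = 2 * (m + 1) by ring, (even_two_mul _).pow_abs]
      rw [ex, ey]
      have e2 : x ^ (2 * m + 1) * y ≤ x ^ (2 * m + 2) + y ^ (2 * m + 2) := by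
        rcases le_total x y with hxy | hxy
        · have : x ^ (2 * m + 1) * y ≤ y ^ (2 * m + 1) * y := by gcongr
          rw [← pow_succ] at this
          have h2 : 0 ≤ x ^ (2 * m + 2) := by positivity
          linarith
        · have : x ^ (2 * m + 1) * y ≤ x ^ (2 * m + 1) * x := by gcongr
          rw [← pow_succ] at this
          have h2 : 0 ≤ y ^ (2 * m + 2) := by positivity
          linarith
      calc |lastProd (σ 0) (σ 1) - q| * x ^ (2 * m + 1) * (β ^ 2 / 2 * y)
          = |lastProd (σ 0) (σ 1) - q| * (β ^ 2 / 2 * (x ^ (2 * m + 1) * y)) := by ring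
        _ ≤ 2 * (β ^ 2 / 2 * (x ^ (2 * m + 1) * y)) := by gcongr
        _ = β ^ 2 * (x ^ (2 * m + 1) * y) := by ring
        _ ≤ β ^ 2 * (x ^ (2 * m + 2) + y ^ (2 * m + 2)) := by gcongr
    have h1 := hpair 0 1 (by norm_num) (by norm_num) (by norm_num) u hu
    have h2 := hpair a b hab ha hb u hu
    have h3 := H.sq_le
    have hY0 : 0 ≤ Y := by
      have := hpair 0 1 (by norm_num) (by norm_num) (by norm_num) u hu
      have h4 : 0 ≤ cavMean N n β h q 4 (fun σ => cavDev N q (σ 0) (σ 1) ^ (2 * m + 2)) u :=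
        pathMean_nonneg u d1 fun σ => by
          rw [show 2 * m + 2 = 2 * (m + 1) by ring]; exact (even_two_mul _).pow_nonneg _
      linarith
    refine hle.trans ?_
    simp only [cavMean] at h1 h2
    nlinarith [sq_nonneg β]
  have := (convex_Icc (0 : ℝ) 1).norm_image_sub_le_of_norm_hasDerivWithin_le
    (fun u hu => hasDerivWithinAt_pathMean (β / √(N : ℝ)) h (β * √q) hF hu) hd
    (left_mem_Icc.2 zero_le_one) (right_mem_Icc.2 zero_le_one)
  simp only [cavMean] at h0
  rw [h0] at this
  simpa using this

/-! ### Moments of the overlap -/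

theorem overlapDev_comp_perm {N n : ℕ} {q : ℝ} (π : Equiv.Perm (Fin n)) (σ τ : Config n) :
    overlapDev N q (σ ∘ π) (τ ∘ π) = overlapDev N q σ τ := by
  unfold overlapDev
  congr 2
  exact Equiv.sum_comp π fun i => spin σ i * spin τ i

/-- Symmetry between sites: one factor `R - q` can be replaced by its contribution from the last
site. -/
theorem cavMean_overlapDev_pow_succ (N n : ℕ) (β h q : ℝ) (r : ℕ) :
    cavMean N n β h q 2 (fun σ => overlapDev N q (σ 0) (σ 1) ^ (r + 1)) 1 =
      ((n + 1 : ℕ) : ℝ) / N * cavMean N n β h q 2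
        (fun σ => lastProd (σ 0) (σ 1) * overlapDev N q (σ 0) (σ 1) ^ r) 1 -
      q * cavMean N n β h q 2 (fun σ => overlapDev N q (σ 0) (σ 1) ^ r) 1 := by
  set s := β / √(N : ℝ)
  set c := β * √q
  let F : Fin (n + 1) → (ℕ → Config (n + 1)) → ℝ := fun i σ =>
    spin (σ 0) i * spin (σ 1) i * overlapDev N q (σ 0) (σ 1) ^ r
  have hF : ∀ i, DependsOn (F i) (Iio 2) := fun i => dependsOn_pair (fun σ τ =>
    spin σ i * spin τ i * overlapDev N q σ τ ^ r) (by norm_num) (by norm_num)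
  have hG : DependsOn (fun σ : ℕ → Config (n + 1) => overlapDev N q (σ 0) (σ 1) ^ r) (Iio 2) :=
    dependsOn_pair (fun σ τ => overlapDev N q σ τ ^ r) (by norm_num) (by norm_num)
  have hexp : (fun σ : ℕ → Config (n + 1) => overlapDev N q (σ 0) (σ 1) ^ (r + 1)) =
      fun σ => 1 / (N : ℝ) * ∑ i, F i σ + (-q) * overlapDev N q (σ 0) (σ 1) ^ r := by
    funext σ
    simp only [F, ← Finset.sum_mul]
    rw [pow_succ]
    nth_rewrite 2 [overlapDev]
    ring
  have hsym : ∀ i, pathMean n s h c 2 (F i) 1 = pathMean n s h c 2 (F (Fin.last n)) 1 :=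
    fun i => by
      rw [pathMean_one, pathMean_one,
        ← sysMean_perm s h (Equiv.swap i (Fin.last n)) 2 (F (Fin.last n))]
      congr 1
      funext σ
      simp only [F, overlapDev_comp_perm]
      simp only [spin, Function.comp_apply, Equiv.swap_apply_right]
  have d1 : DependsOn (fun σ => ∑ i, F i σ) (Iio 2) := fun σ τ hst =>
    Finset.sum_congr rfl fun i _ => hF i hst
  rw [cavMean, hexp, pathMean_add, pathMean_const_mul, pathMean_const_mul,
    pathMean_sum _ _ _ fun i _ => hF i, Finset.sum_congr rfl fun i _ => hsym i,
    Finset.sum_const, Finset.card_univ, Fintype.card_fin, nsmul_eq_mul]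
  · simp only [F, lastProd]
    ring
  · exact fun σ τ hst => congrArg _ (d1 hst)
  · exact fun σ τ hst => congrArg _ (hG hst)

/-- For the system of `n + 1` sites, the moments of order `2 m` of `R - q` and of `R⁻ - q` are of
order `N^{-m}`. -/
theorem exists_moment_bound (h : ℝ) (m : ℕ) : ∃ C : ℝ, 0 ≤ C ∧ ∀ (β q : ℝ) (N n : ℕ),
    IsAdmissible h β q N n →
      cavMean N n β h q 2 (fun σ => cavDev N q (σ 0) (σ 1) ^ (2 * m)) 1 ≤ C / (N : ℝ) ^ m ∧
      cavMean N n β h q 2 (fun σ => overlapDev N q (σ 0) (σ 1) ^ (2 * m)) 1 ≤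
        C / (N : ℝ) ^ m := by
  induction m with
  | zero => exact ⟨1, zero_le_one, fun β q N n _ => by simp [pathMean_const]⟩
  | succ m ih =>
    obtain ⟨C, hC0, hC⟩ := ih
    refine ⟨(10 * m + 10) * (2 * C), by positivity, fun β q N n H => ?_⟩
    obtain ⟨hV, hW⟩ := hC β q N n H
    have hq := H.isOverlapParameter
    have hN : (0 : ℝ) < N := lt_of_lt_of_le one_pos H.one_le_cast
    set V := cavMean N n β h q 2 (fun σ => cavDev N q (σ 0) (σ 1) ^ (2 * m)) 1
    set W := cavMean N n β h q 2 (fun σ => overlapDev N q (σ 0) (σ 1) ^ (2 * m)) 1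
    set Y := cavMean N n β h q 2 (fun σ => cavDev N q (σ 0) (σ 1) ^ (2 * m + 2)) 1
    set X := cavMean N n β h q 2 (fun σ => overlapDev N q (σ 0) (σ 1) ^ (2 * m + 2)) 1
    set E := (V + W) / N with hE
    have dV : DependsOn (fun σ : ℕ → Config (n + 1) => cavDev N q (σ 0) (σ 1) ^ (2 * m))
      (Iio 2) := dependsOn_pair (fun σ τ => cavDev N q σ τ ^ (2 * m)) (by norm_num) (by norm_num)
    have dW : DependsOn (fun σ : ℕ → Config (n + 1) => overlapDev N q (σ 0) (σ 1) ^ (2 * m))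
      (Iio 2) :=
        dependsOn_pair (fun σ τ => overlapDev N q σ τ ^ (2 * m)) (by norm_num) (by norm_num)
    have hV0 : 0 ≤ V := pathMean_nonneg 1 dV fun σ => (even_two_mul m).pow_nonneg _
    have hW0 : 0 ≤ W := pathMean_nonneg 1 dW fun σ => (even_two_mul m).pow_nonneg _
    have hE0 : 0 ≤ E := by positivity
    -- the two overlaps differ by at most `1 / N`
    have hmax : ∀ σ τ : Config (n + 1), max |overlapDev N q σ τ| |cavDev N q σ τ| ^ (2 * m) ≤
        cavDev N q σ τ ^ (2 * m) + overlapDev N q σ τ ^ (2 * m) := fun σ τ => by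
      have h1 := (even_two_mul m).pow_nonneg (cavDev N q σ τ)
      have h2 := (even_two_mul m).pow_nonneg (overlapDev N q σ τ)
      rcases max_choice |overlapDev N q σ τ| |cavDev N q σ τ| with h | h <;> rw [h] <;>
        rw [(even_two_mul m).pow_abs] <;> linarith
    have hsub : ∀ σ τ : Config (n + 1), |overlapDev N q σ τ - cavDev N q σ τ| = 1 / N :=
      fun σ τ => by
        rw [overlapDev_eq_cavDev, add_sub_cancel_left, abs_div, abs_lastProd, abs_of_pos hN]
    have hodd : ∀ σ τ : Config (n + 1),
        |overlapDev N q σ τ ^ (2 * m + 1) - cavDev N q σ τ ^ (2 * m + 1)| ≤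
        (2 * m + 1) / N * (cavDev N q σ τ ^ (2 * m) + overlapDev N q σ τ ^ (2 * m)) :=
      fun σ τ => by
        refine (abs_pow_sub_pow_le _ _ _).trans ?_
        rw [hsub, Nat.add_sub_cancel]
        push_cast
        rw [one_div_mul_eq_div]
        exact mul_le_mul_of_nonneg_left (hmax σ τ) (by positivity)
    have heven : ∀ σ τ : Config (n + 1),
        |overlapDev N q σ τ ^ (2 * m + 2) - cavDev N q σ τ ^ (2 * m + 2)| ≤
        (4 * m + 4) / N * (cavDev N q σ τ ^ (2 * m) + overlapDev N q σ τ ^ (2 * m)) :=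
      fun σ τ => by
        refine (abs_pow_sub_pow_le _ _ _).trans ?_
        rw [hsub, show 2 * m + 2 - 1 = 2 * m + 1 from rfl, pow_succ]
        push_cast
        have h2 : max |overlapDev N q σ τ| |cavDev N q σ τ| ≤ 2 :=
          max_le (H.abs_dev_le σ τ) (H.abs_cavDev_le σ τ)
        have h3 : 0 ≤ max |overlapDev N q σ τ| |cavDev N q σ τ| :=
          (abs_nonneg _).trans (le_max_left _ _)
        calc 1 / (N : ℝ) * (2 * m + 2) * (max |overlapDev N q σ τ| |cavDev N q σ τ| ^ (2 * m) *
              max |overlapDev N q σ τ| |cavDev N q σ τ|)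
            ≤ 1 / (N : ℝ) * (2 * m + 2) *
              ((cavDev N q σ τ ^ (2 * m) + overlapDev N q σ τ ^ (2 * m)) * 2) := by
              gcongr
              · exact add_nonneg ((even_two_mul m).pow_nonneg _) ((even_two_mul m).pow_nonneg _)
              · exact hmax σ τ
          _ = _ := by ring
    have dVW : ∀ a : ℝ, DependsOn (fun σ : ℕ → Config (n + 1) =>
        a * (cavDev N q (σ 0) (σ 1) ^ (2 * m) + overlapDev N q (σ 0) (σ 1) ^ (2 * m))) (Iio 2) :=
      fun a => dependsOn_pair (fun σ τ => a * (cavDev N q σ τ ^ (2 * m) +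
        overlapDev N q σ τ ^ (2 * m))) (by norm_num) (by norm_num)
    have hYX : Y ≤ X + (4 * m + 4) * E := by
      have e1 : X + (4 * m + 4) * E = cavMean N n β h q 2 (fun σ =>
          overlapDev N q (σ 0) (σ 1) ^ (2 * m + 2) + (4 * m + 4) / N *
            (cavDev N q (σ 0) (σ 1) ^ (2 * m) + overlapDev N q (σ 0) (σ 1) ^ (2 * m))) 1 := by
        rw [cavMean, pathMean_add _ (dependsOn_pair (fun σ τ => overlapDev N q σ τ ^ (2 * m + 2))
          (by norm_num) (by norm_num)) (dVW _), pathMean_const_mul, pathMean_add _ dV dW]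
        simp only [X, E, V, W]
        ring
      rw [e1]
      refine pathMean_mono _ (dependsOn_pair (fun σ τ => cavDev N q σ τ ^ (2 * m + 2))
        (by norm_num) (by norm_num)) (dependsOn_pair (fun σ τ => overlapDev N q σ τ ^ (2 * m + 2) +
          (4 * m + 4) / N * (cavDev N q σ τ ^ (2 * m) + overlapDev N q σ τ ^ (2 * m)))
          (by norm_num) (by norm_num)) fun σ => ?_
      have := (abs_le.1 (heven (σ 0) (σ 1))).1
      linarith
    set R := cavMean N n β h q 2 (fun σ => (lastProd (σ 0) (σ 1) - q) *
      overlapDev N q (σ 0) (σ 1) ^ (2 * m + 1)) 1 with hR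
    have hRY : R ≤ Y / 5 + (4 * m + 2) * E := by
      have hcen := (le_abs_self _).trans (abs_cavMean_centred_le H m)
      have e1 : cavMean N n β h q 2 (fun σ => (lastProd (σ 0) (σ 1) - q) *
          cavDev N q (σ 0) (σ 1) ^ (2 * m + 1)) 1 + (4 * m + 2) * E =
          cavMean N n β h q 2 (fun σ => (lastProd (σ 0) (σ 1) - q) *
            cavDev N q (σ 0) (σ 1) ^ (2 * m + 1) + (4 * m + 2) / N *
            (cavDev N q (σ 0) (σ 1) ^ (2 * m) + overlapDev N q (σ 0) (σ 1) ^ (2 * m))) 1 := by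
        rw [cavMean, cavMean, pathMean_add _ (dependsOn_pair (fun σ τ => (lastProd σ τ - q) *
            cavDev N q σ τ ^ (2 * m + 1)) (by norm_num) (by norm_num)) (dVW _),
          pathMean_const_mul, pathMean_add _ dV dW]
        simp only [E, V, W]
        ring
      have e2 : R ≤ cavMean N n β h q 2 (fun σ => (lastProd (σ 0) (σ 1) - q) *
          cavDev N q (σ 0) (σ 1) ^ (2 * m + 1)) 1 + (4 * m + 2) * E := by
        rw [e1]
        refine pathMean_mono _ (dependsOn_pair (fun σ τ => (lastProd σ τ - q) *
          overlapDev N q σ τ ^ (2 * m + 1)) (by norm_num) (by norm_num)) (dependsOn_pair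
          (fun σ τ => (lastProd σ τ - q) * cavDev N q σ τ ^ (2 * m + 1) + (4 * m + 2) / N *
            (cavDev N q σ τ ^ (2 * m) + overlapDev N q σ τ ^ (2 * m)))
          (by norm_num) (by norm_num)) fun σ => ?_
        have h1 : |lastProd (σ 0) (σ 1) - q| ≤ 2 := by
          have := abs_le.1 (abs_lastProd (σ 0) (σ 1)).le
          rw [abs_le]
          constructor <;> linarith [hq.nonneg, hq.le_one, this.1, this.2]
        have h2 := mul_le_mul h1 (hodd (σ 0) (σ 1)) (abs_nonneg _) zero_le_two
        rw [← abs_mul] at h2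
        have h3 := (le_abs_self _).trans h2
        calc _ ≤ (lastProd (σ 0) (σ 1) - q) * cavDev N q (σ 0) (σ 1) ^ (2 * m + 1) +
              2 * ((2 * m + 1) / N * (cavDev N q (σ 0) (σ 1) ^ (2 * m) +
                overlapDev N q (σ 0) (σ 1) ^ (2 * m))) := by linarith
          _ = _ := by ring
      linarith
    have hXR : X ≤ Y / 5 + (4 * m + 2) * E + 2 * E := by
      have hsym := cavMean_overlapDev_pow_succ N n β h q (2 * m + 1)
      set P := cavMean N n β h q 2 (fun σ => lastProd (σ 0) (σ 1) *
        overlapDev N q (σ 0) (σ 1) ^ (2 * m + 1)) 1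
      set Q := cavMean N n β h q 2 (fun σ => overlapDev N q (σ 0) (σ 1) ^ (2 * m + 1)) 1
      have dQ : DependsOn (fun σ : ℕ → Config (n + 1) => overlapDev N q (σ 0) (σ 1) ^ (2 * m + 1))
        (Iio 2) := dependsOn_pair (fun σ τ => overlapDev N q σ τ ^ (2 * m + 1))
          (by norm_num) (by norm_num)
      have hPQ : R = P - q * Q := by
        have : R = cavMean N n β h q 2 (fun σ => lastProd (σ 0) (σ 1) *
            overlapDev N q (σ 0) (σ 1) ^ (2 * m + 1) +
            (-q) * overlapDev N q (σ 0) (σ 1) ^ (2 * m + 1)) 1 := by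
          rw [hR]
          congr 1
          funext σ
          ring
        rw [this, cavMean, pathMean_add _ (dependsOn_pair (fun σ τ => lastProd σ τ *
            overlapDev N q σ τ ^ (2 * m + 1)) (by norm_num) (by norm_num))
          (fun σ τ hst => congrArg _ (dQ hst)), pathMean_const_mul]
        simp only [P, Q]
        ring
      have hQ : |Q| ≤ 2 * W := by
        refine (abs_pathMean_le 1 dQ).trans ?_
        rw [← pathMean_const_mul]
        refine pathMean_mono 1 (fun σ τ hst => congrArg _ (dQ hst))
          (fun σ τ hst => congrArg _ (dW hst)) fun σ => ?_
        rw [pow_succ, abs_mul, abs_of_nonneg ((even_two_mul m).pow_nonneg _), mul_comm]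
        exact mul_le_mul_of_nonneg_right (H.abs_dev_le _ _) ((even_two_mul m).pow_nonneg _)
      set ρ : ℝ := ((n + 1 : ℕ) : ℝ) / N with hρ
      have hρ0 : 0 ≤ ρ := by positivity
      have hρ1 : ρ ≤ 1 := by
        rw [hρ, div_le_one hN]
        exact_mod_cast H.le_size
      have hρ2 : 1 - ρ ≤ 1 / N := by
        rw [hρ, sub_le_iff_le_add, ← add_div, le_div_iff₀ hN]
        have : N ≤ 1 + (n + 1) := by have := H.size_le; omega
        have : (N : ℝ) ≤ 1 + ((n + 1 : ℕ) : ℝ) := by exact_mod_cast this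
        linarith
      have hX : X = ρ * R - (1 - ρ) * (q * Q) := by
        have : X = ρ * P - q * Q := hsym
        rw [this, hPQ]; ring
      have hY0 : 0 ≤ Y := pathMean_nonneg 1 (dependsOn_pair
        (fun σ τ => cavDev N q σ τ ^ (2 * m + 2)) (by norm_num) (by norm_num)) fun σ => by
          rw [show 2 * m + 2 = 2 * (m + 1) by ring]; exact (even_two_mul _).pow_nonneg _
      have b1 : ρ * R ≤ Y / 5 + (4 * m + 2) * E := by
        have : 0 ≤ Y / 5 + (4 * m + 2) * E := by positivity
        nlinarith
      have b2 : -((1 - ρ) * (q * Q)) ≤ 2 * E := by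
        have hqQ : |q * Q| ≤ 2 * W := by
          rw [abs_mul, abs_of_nonneg hq.nonneg]
          nlinarith [abs_nonneg Q, hq.le_one]
        calc -((1 - ρ) * (q * Q)) ≤ |(1 - ρ) * (q * Q)| := neg_le_abs _
          _ = (1 - ρ) * |q * Q| := by rw [abs_mul, abs_of_nonneg (by linarith)]
          _ ≤ 1 / N * (2 * W) := by gcongr
          _ ≤ 1 / N * (2 * (V + W)) := by gcongr; linarith
          _ = 2 * E := by rw [hE]; ring
      linarith
    have hEC : E ≤ 2 * C / (N : ℝ) ^ (m + 1) := by
      rw [hE, pow_succ, ← div_div]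
      refine div_le_div_of_nonneg_right ?_ hN.le
      calc V + W ≤ C / (N : ℝ) ^ m + C / (N : ℝ) ^ m := add_le_add hV hW
        _ = 2 * C / (N : ℝ) ^ m := by ring
    have hm0 : (0 : ℝ) ≤ m := Nat.cast_nonneg m
    have hfin : (10 * m + 10) * E ≤ (10 * m + 10) * (2 * C) / (N : ℝ) ^ (m + 1) := by
      rw [mul_div_assoc]
      exact mul_le_mul_of_nonneg_left hEC (by positivity)
    constructor
    · change Y ≤ _
      nlinarith
    · change X ≤ _
      nlinarith

theorem exists_moment_bound_path (h : ℝ) (m : ℕ) : ∃ C : ℝ, 0 ≤ C ∧ ∀ (β q : ℝ) (N n : ℕ),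
    IsAdmissible h β q N n → ∀ t ∈ Icc (0 : ℝ) 1, ∀ k a b, a ≠ b → a < k → b < k →
      cavMean N n β h q k (fun σ => cavDev N q (σ a) (σ b) ^ (2 * m)) t ≤ C / (N : ℝ) ^ m := by
  obtain ⟨C, hC0, hC⟩ := exists_moment_bound h m
  refine ⟨2 * C, by positivity, fun β q N n H t ht k a b hab ha hb => ?_⟩
  rw [cavMean, pathMean_pair (fun σ τ => cavDev N q σ τ ^ (2 * m)) hab ha hb]
  have h1 := cavMean_le_two_mul H (dependsOn_pair (fun σ τ => cavDev N q σ τ ^ (2 * m))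
    (by norm_num : 0 < 2) (by norm_num : 1 < 2)) (fun σ => (even_two_mul m).pow_nonneg _) ht
  have h2 := (hC β q N n H).1
  rw [mul_div_assoc]
  linarith

/-- Lists of pairs of distinct replicas among the first `k`. -/
def IsPairList (k : ℕ) (L : List (ℕ × ℕ)) : Prop := ∀ x ∈ L, x.1 ≠ x.2 ∧ x.1 < k ∧ x.2 < k

/-- The product of the functions `u (σ a) (σ b)` over the pairs `(a, b)` of a list. -/
def pairProd {S : Type*} (u : S → S → ℝ) (L : List (ℕ × ℕ)) (σ : ℕ → S) : ℝ :=
  (L.map fun x => u (σ x.1) (σ x.2)).prod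

theorem pairProd_nil {S : Type*} (u : S → S → ℝ) (σ : ℕ → S) : pairProd u [] σ = 1 := rfl

theorem pairProd_cons {S : Type*} (u : S → S → ℝ) (x : ℕ × ℕ) (L : List (ℕ × ℕ)) (σ : ℕ → S) :
    pairProd u (x :: L) σ = u (σ x.1) (σ x.2) * pairProd u L σ := by
  simp [pairProd]

theorem isPairList_cons {k : ℕ} {x : ℕ × ℕ} {L : List (ℕ × ℕ)} :
    IsPairList k (x :: L) ↔ (x.1 ≠ x.2 ∧ x.1 < k ∧ x.2 < k) ∧ IsPairList k L := by
  simp [IsPairList]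

theorem IsPairList.mono {k m : ℕ} {L : List (ℕ × ℕ)} (hL : IsPairList k L) (h : k ≤ m) :
    IsPairList m L :=
  fun x hx => ⟨(hL x hx).1, (hL x hx).2.1.trans_le h, (hL x hx).2.2.trans_le h⟩

theorem dependsOn_pairProd {S : Type*} (u : S → S → ℝ) {k : ℕ} {L : List (ℕ × ℕ)}
    (hL : IsPairList k L) : DependsOn (pairProd u L) (Iio k) := fun σ τ hst => by
  unfold pairProd
  congr 1
  refine List.map_congr_left fun x hx => ?_
  rw [hst _ (hL x hx).2.1, hst _ (hL x hx).2.2]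

theorem prod_le_one_add_sum_pow {m : ℕ} (y : Fin m → ℝ) (hy : ∀ i, 0 ≤ y i) :
    ∏ i, y i ≤ 1 + ∑ i, y i ^ (2 * m) := by
  have hs : 0 ≤ ∑ i, y i ^ (2 * m) := Finset.sum_nonneg fun i _ => (even_two_mul m).pow_nonneg _
  by_cases h1 : ∀ i, y i ≤ 1
  · have := Finset.prod_le_one (s := Finset.univ) (fun i _ => hy i) fun i _ => h1 i
    linarith
  · push Not at h1
    obtain ⟨j, hj⟩ := h1
    obtain ⟨i, -, hi⟩ := Finset.exists_max_image Finset.univ y ⟨j, Finset.mem_univ j⟩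
    have h2 : ∏ l, y l ≤ y i ^ m := by
      refine (Finset.prod_le_prod (fun l _ => hy l) fun l hl => hi l hl).trans_eq ?_
      simp
    have h3 : 1 ≤ y i := hj.le.trans (hi j (Finset.mem_univ j))
    have h4 : y i ^ m ≤ y i ^ (2 * m) := pow_le_pow_right₀ h3 (by omega)
    have h5 := Finset.single_le_sum (f := fun i => y i ^ (2 * m))
      (fun i _ => (even_two_mul m).pow_nonneg _) (Finset.mem_univ i)
    linarith

/-- A product of `m` deviations of overlaps is of order `N^{-m/2}` in mean. -/
theorem exists_pairProd_bound (h : ℝ) (m : ℕ) : ∃ C : ℝ, 0 ≤ C ∧ ∀ (β q : ℝ) (N n : ℕ),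
    IsAdmissible h β q N n → ∀ t ∈ Icc (0 : ℝ) 1, ∀ k L, IsPairList k L → L.length = m →
      cavMean N n β h q k (fun σ => |pairProd (cavDev N q) L σ|) t ≤ C / √(N : ℝ) ^ m := by
  obtain ⟨C, hC0, hC⟩ := exists_moment_bound_path h m
  refine ⟨1 + m * C, by positivity, fun β q N n H t ht k L hL hm => ?_⟩
  subst hm
  have hN : (0 : ℝ) < N := lt_of_lt_of_le one_pos H.one_le_cast
  have hs : 0 < √(N : ℝ) := Real.sqrt_pos.2 hN
  have hmem : ∀ i : Fin L.length, L.get i ∈ L := fun i => List.get_mem L i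
  rw [le_div_iff₀ (by positivity), mul_comm, ← pathMean_const_mul]
  have d0 : DependsOn (fun σ => |pairProd (cavDev N q) L σ|) (Iio k) := fun σ τ hst =>
    congrArg _ (dependsOn_pairProd (cavDev N q (n := n)) hL hst)
  have d1 : ∀ i ∈ Finset.univ, DependsOn (fun σ : ℕ → Config (n + 1) => (N : ℝ) ^ L.length *
      cavDev N q (σ (L.get i).1) (σ (L.get i).2) ^ (2 * L.length)) (Iio k) :=
    fun (i : Fin L.length) _ => dependsOn_pair
      (fun σ τ => (N : ℝ) ^ L.length * cavDev N q σ τ ^ (2 * L.length))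
      (hL _ (hmem i)).2.1 (hL _ (hmem i)).2.2
  have hle : cavMean N n β h q k (fun σ => √(N : ℝ) ^ L.length * |pairProd (cavDev N q) L σ|) t ≤
      cavMean N n β h q k (fun σ => 1 + ∑ i : Fin L.length, (N : ℝ) ^ L.length *
        cavDev N q (σ (L.get i).1) (σ (L.get i).2) ^ (2 * L.length)) t := by
    refine pathMean_mono t (fun σ τ hst => congrArg _ (d0 hst)) (fun σ τ hst => congrArg _
      (Finset.sum_congr rfl fun i hi => d1 i hi hst)) fun σ => ?_
    have h1 := prod_le_one_add_sum_pow
      (fun i : Fin L.length => √(N : ℝ) * |cavDev N q (σ (L.get i).1) (σ (L.get i).2)|)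
      (fun i => by positivity)
    rw [Finset.prod_mul_distrib, Finset.prod_const, Finset.card_univ, Fintype.card_fin,
      ← Finset.abs_prod] at h1
    have h2 : ∏ i : Fin L.length, cavDev N q (σ (L.get i).1) (σ (L.get i).2) =
        pairProd (cavDev N q) L σ :=
      Fin.prod_univ_fun_getElem L fun x => cavDev N q (σ x.1) (σ x.2)
    rw [h2] at h1
    refine h1.trans_eq ?_
    congr 1
    refine Finset.sum_congr rfl fun i _ => ?_
    rw [mul_pow, pow_mul, Real.sq_sqrt hN.le, (even_two_mul _).pow_abs]
  refine hle.trans ?_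
  rw [cavMean, pathMean_add t (fun _ _ _ => rfl) (fun σ τ hst =>
    Finset.sum_congr rfl fun i hi => d1 i hi hst), pathMean_const, pathMean_sum _ _ _ d1]
  gcongr
  refine (Finset.sum_le_card_nsmul _ _ C fun i _ => ?_).trans_eq (by simp)
  rw [pathMean_const_mul]
  have := hC β q N n H t ht k _ _ (hL _ (hmem i)).1 (hL _ (hmem i)).2.1 (hL _ (hmem i)).2.2
  rw [le_div_iff₀ (by positivity)] at this
  rw [mul_comm]
  exact this

/-! ### Products of differences of spins -/

/-- The derivative of order `l` of the mean of a function that is dominated by a product of `m`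
deviations of overlaps is of order `N^{-(m + l) / 2}`: each derivative brings one more deviation. -/
theorem exists_pathMeanDeriv_bound (h : ℝ) (l m k : ℕ) : ∃ C : ℝ, 0 ≤ C ∧ ∀ (β q : ℝ) (N n : ℕ),
    IsAdmissible h β q N n → ∀ t ∈ Icc (0 : ℝ) 1, ∀ (F : (ℕ → Config (n + 1)) → ℝ) (B : ℝ)
      (L : List (ℕ × ℕ)), DependsOn F (Iio k) → IsPairList k L → L.length = m → 0 ≤ B →
      (∀ σ, |F σ| ≤ B * |pairProd (cavDev N q) L σ|) →
      |pathMeanDeriv n (β / √(N : ℝ)) h (β * √q) l k F t| ≤ B * (C / √(N : ℝ) ^ (m + l)) := by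
  induction l generalizing m k with
  | zero =>
    obtain ⟨C, hC0, hC⟩ := exists_pairProd_bound h m
    refine ⟨C, hC0, fun β q N n H t ht F B L hF hL hm hB hFB => ?_⟩
    rw [pathMeanDeriv_zero]
    refine (abs_pathMean_le t hF).trans ?_
    refine le_trans ?_ (mul_le_mul_of_nonneg_left (hC β q N n H t ht k L hL hm) hB)
    rw [← pathMean_const_mul]
    exact pathMean_mono t (fun σ τ hst => congrArg _ (hF hst)) (fun σ τ hst =>
      congrArg (fun x => B * |x|) (dependsOn_pairProd (cavDev N q (n := n)) hL hst)) hFB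
  | succ l ih =>
    obtain ⟨C, hC0, hC⟩ := ih (m + 1) (k + 2)
    refine ⟨totalWeight k * C, mul_nonneg (totalWeight_nonneg k) hC0,
      fun β q N n H t ht F B L hF hL hm hB hFB => ?_⟩
    rw [pathMeanDeriv_succ l hF ht]
    refine (Finset.abs_sum_le_sum_abs _ _).trans ?_
    rw [mul_div_assoc, mul_left_comm, totalWeight, Finset.sum_mul]
    refine Finset.sum_le_sum fun x hx => ?_
    rw [abs_mul]
    refine mul_le_mul_of_nonneg_left ?_ (abs_nonneg _)
    have hx' : x.1 ≠ x.2 ∧ x.1 < k + 2 ∧ x.2 < k + 2 := by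
      simp only [Finset.mem_offDiag, Finset.mem_range] at hx
      exact ⟨hx.2.2, hx.1, hx.2.1⟩
    have := hC β q N n H t ht (fun σ => F σ * covDeriv (β / √(N : ℝ)) (β * √q) (σ x.1) (σ x.2)) B
      (x :: L) (dependsOn_mul_covDeriv _ _ hF hx)
      (isPairList_cons.2 ⟨hx', hL.mono (by omega)⟩) (by simp [hm]) hB fun σ => ?_
    · rwa [show m + (l + 1) = m + 1 + l by ring]
    · rw [abs_mul, abs_covDeriv_eq H.isOverlapParameter.nonneg, pairProd_cons, abs_mul]
      have h1 := H.sq_le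
      calc |F σ| * (β ^ 2 / 2 * |cavDev N q (σ x.1) (σ x.2)|)
          ≤ B * |pairProd (cavDev N q) L σ| * (1 * |cavDev N q (σ x.1) (σ x.2)|) := by
            gcongr
            · exact hFB σ
            · linarith
        _ = _ := by ring

/-- The product over `r < p` of the differences `u (σ (2 r)) - u (σ (2 r + 1))`. -/
def diffMon {S : Type*} (p : ℕ) (u : S → ℝ) (σ : ℕ → S) : ℝ :=
  ∏ r ∈ Finset.range p, (u (σ (2 * r)) - u (σ (2 * r + 1)))

theorem dependsOn_diffMon {S : Type*} {p k : ℕ} (hk : 2 * p ≤ k) (u : S → ℝ) :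
    DependsOn (diffMon p u) (Iio k) := fun σ τ hst =>
  Finset.prod_congr rfl fun r hr => by
    have hr' := Finset.mem_range.1 hr
    rw [hst (2 * r) (show 2 * r < k by omega), hst (2 * r + 1) (show 2 * r + 1 < k by omega)]

theorem abs_diffMon_le {S : Type*} (p : ℕ) {u : S → ℝ} (hu : ∀ s, |u s| = 1) (σ : ℕ → S) :
    |diffMon p u σ| ≤ 2 ^ p := by
  rw [diffMon, Finset.abs_prod]
  refine (Finset.prod_le_prod (fun r _ => abs_nonneg _) fun r _ => ?_).trans_eq
    (by rw [Finset.prod_const, Finset.card_range])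
  exact (abs_sub _ _).trans (by rw [hu, hu]; norm_num)

theorem abs_pairProd_eq_one {S : Type*} {u : S → ℝ} (hu : ∀ s, |u s| = 1) (A : List (ℕ × ℕ))
    (σ : ℕ → S) : |pairProd (fun s t => u s * u t) A σ| = 1 := by
  induction A with
  | nil => simp [pairProd_nil]
  | cons x A ih => rw [pairProd_cons, abs_mul, ih, abs_mul, hu, hu]; norm_num

/-- A product of `p` differences times fewer than `p / 2` products of pairs averages to zero: some
difference involves two replicas that occur nowhere else, and exchanging these replicas changes
the sign. -/
theorem avg_diffMon_mul_pairProd_eq_zero {S : Type*} [Inhabited S] [Fintype S] {k p : ℕ}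
    (w : S → ℝ) (u : S → ℝ) {A : List (ℕ × ℕ)} (hk : 2 * p ≤ k) (hA : 2 * A.length < p) :
    avg k w (fun σ => diffMon p u σ * pairProd (fun s t => u s * u t) A σ) = 0 := by
  classical
  have hcard : (A.flatMap fun x => [x.1 / 2, x.2 / 2]).toFinset.card < (Finset.range p).card := by
    refine (List.toFinset_card_le _).trans_lt ?_
    rw [Finset.card_range, List.length_flatMap]
    simpa [mul_comm] using hA
  obtain ⟨r, hr, hrA⟩ := Finset.exists_mem_notMem_of_card_lt_card hcard
  have hrp := Finset.mem_range.1 hr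
  rw [List.mem_toFinset, List.mem_flatMap] at hrA
  push Not at hrA
  have hfix : ∀ j, j / 2 ≠ r → Equiv.swap (2 * r) (2 * r + 1) j = j := fun j hj =>
    Equiv.swap_apply_of_ne_of_ne (by omega) (by omega)
  have hswap := avg_swap w (fun σ => diffMon p u σ * pairProd (fun s t => u s * u t) A σ)
    (show 2 * r < k by omega) (show 2 * r + 1 < k by omega)
  have hneg : ∀ σ : ℕ → S, diffMon p u (σ ∘ Equiv.swap (2 * r) (2 * r + 1)) *
      pairProd (fun s t => u s * u t) A (σ ∘ Equiv.swap (2 * r) (2 * r + 1)) =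
      (-1) * (diffMon p u σ * pairProd (fun s t => u s * u t) A σ) := fun σ => by
    have h1 : pairProd (fun s t => u s * u t) A (σ ∘ Equiv.swap (2 * r) (2 * r + 1)) =
        pairProd (fun s t => u s * u t) A σ := by
      unfold pairProd
      congr 1
      refine List.map_congr_left fun x hx => ?_
      have := hrA x hx
      simp only [List.mem_cons, List.not_mem_nil, or_false, not_or] at this
      simp only [Function.comp_apply]
      rw [hfix _ (Ne.symm this.1), hfix _ (Ne.symm this.2)]
    have h2 : diffMon p u (σ ∘ Equiv.swap (2 * r) (2 * r + 1)) = -diffMon p u σ := by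
      unfold diffMon
      rw [← Finset.mul_prod_erase _ _ hr,
        ← Finset.mul_prod_erase _ (fun r => u (σ (2 * r)) - u (σ (2 * r + 1))) hr, ← neg_mul]
      congr 1
      · simp
      · refine Finset.prod_congr rfl fun j hj => ?_
        have := Finset.ne_of_mem_erase hj
        simp only [Function.comp_apply]
        rw [hfix _ (by omega), hfix _ (by omega)]
    rw [h1, h2]
    ring
  simp only [hneg, avg_const_mul] at hswap
  linarith

/-- A sign as a real number. -/
def unitVal (ε : ℤˣ) : ℝ := ((ε : ℤ) : ℝ)

theorem abs_unitVal (ε : ℤˣ) : |unitVal ε| = 1 := by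
  unfold unitVal
  rcases Int.units_eq_one_or ε with h | h <;> simp [h]

/-- The monomials in the last spins of the replicas that occur in the derivatives along the smart
path: the product of `p` differences and of the pairs listed in `A`. -/
def unitMon (p : ℕ) (A : List (ℕ × ℕ)) (ε : ℕ → ℤˣ) : ℝ :=
  diffMon p unitVal ε * pairProd (fun a b => unitVal a * unitVal b) A ε

theorem abs_unitMon_le (p : ℕ) (A : List (ℕ × ℕ)) (ε : ℕ → ℤˣ) : |unitMon p A ε| ≤ 2 ^ p := by
  rw [unitMon, abs_mul, abs_pairProd_eq_one abs_unitVal, mul_one]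
  exact abs_diffMon_le p abs_unitVal ε

/-- The product of a monomial in the last spins and of a function of the other spins. -/
def splitFun {n : ℕ} (p : ℕ) (A : List (ℕ × ℕ)) (G : (ℕ → Config n) → ℝ)
    (σ : ℕ → Config (n + 1)) : ℝ :=
  unitMon p A (fun r => σ r (Fin.last n)) * G fun r => init (σ r)

section SplitFun

variable {n p k : ℕ} {A : List (ℕ × ℕ)} {G : (ℕ → Config n) → ℝ}

theorem dependsOn_splitFun (hk : 2 * p ≤ k) (hA : IsPairList k A) (hG : DependsOn G (Iio k)) :
    DependsOn (splitFun p A G) (Iio k) := fun σ τ hst => by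
  unfold splitFun unitMon
  rw [dependsOn_diffMon hk unitVal fun r hr => congrFun (hst r hr) _,
    dependsOn_pairProd _ hA fun r hr => congrFun (hst r hr) _,
    hG fun r hr => congrArg init (hst r hr)]

theorem splitFun_mul_covDeriv (s c : ℝ) (x : ℕ × ℕ) (σ : ℕ → Config (n + 1)) :
    splitFun p A G σ * covDeriv s c (σ x.1) (σ x.2) = splitFun p (x :: A) (fun ρ => G ρ *
      ((s ^ 2 * ∑ i, spin (ρ x.1) i * spin (ρ x.2) i - c ^ 2) / 2)) σ := by
  simp only [splitFun, unitMon, covDeriv, pairProd_cons]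
  simp only [unitVal, spin]
  ring

/-- A derivative at `t = 0` vanishes if its order is too small for all the replicas in the
differences of last spins to be matched. -/
theorem pathMeanDeriv_splitFun_eq_zero (s h c : ℝ) (l : ℕ) (hk : 2 * p ≤ k)
    (hA : IsPairList k A) (hG : DependsOn G (Iio k)) (hl : 2 * (A.length + l) < p) :
    pathMeanDeriv n s h c l k (splitFun p A G) 0 = 0 := by
  induction l generalizing k A G with
  | zero =>
    rw [pathMeanDeriv_zero]
    refine (pathMean_zero s h c k (unitMon p A) G).trans ?_
    have : ∀ z, avg k (lastWeight (c * z + h)) (unitMon p A) = 0 := fun z =>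
      avg_diffMon_mul_pairProd_eq_zero _ unitVal hk hl
    simp [lastMean, this]
  | succ l ih =>
    rw [pathMeanDeriv_succ l (dependsOn_splitFun hk hA hG) (left_mem_Icc.2 zero_le_one)]
    refine Finset.sum_eq_zero fun x hx => ?_
    simp only [Finset.mem_offDiag, Finset.mem_range] at hx
    simp only [splitFun_mul_covDeriv]
    refine mul_eq_zero_of_right _ (ih (by omega)
      (isPairList_cons.2 ⟨⟨hx.2.2, hx.1, hx.2.1⟩, hA.mono (by omega)⟩) ?_ ?_)
    · refine DependsOn.mul (dependsOn_mono hG (Iio_subset_Iio (by omega))) ?_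
      exact dependsOn_pair (fun ρ ρ' : Config n =>
        (s ^ 2 * ∑ i, spin ρ i * spin ρ' i - c ^ 2) / 2) hx.1 hx.2.1
    · rw [List.length_cons]
      omega

end SplitFun

theorem abs_sub_taylor_le {ψ : ℝ → ℝ} (hψ : ContDiffOn ℝ ∞ ψ (Icc 0 1)) (m : ℕ) {C : ℝ}
    (hC : ∀ t ∈ Icc (0 : ℝ) 1, |iteratedDerivWithin (m + 1) ψ (Icc 0 1) t| ≤ C) :
    |ψ 1 - ∑ j ∈ Finset.range (m + 1), (j ! : ℝ)⁻¹ * iteratedDerivWithin j ψ (Icc 0 1) 0| ≤ C := by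
  have h := taylor_mean_remainder_bound (n := m) zero_le_one
    (hψ.of_le (by exact_mod_cast le_top)) (right_mem_Icc.2 zero_le_one) hC
  simp only [taylor_within_apply, sub_zero, one_pow, mul_one, smul_eq_mul] at h
  refine h.trans (div_le_self ((abs_nonneg _).trans (hC 0 (left_mem_Icc.2 zero_le_one))) ?_)
  exact_mod_cast Nat.one_le_iff_ne_zero.2 (Nat.factorial_ne_zero m)

/-- Products of `p` differences of last spins and of `m₁ + m₂` deviations of overlaps, for the
system of `n + 1` sites. Each deviation contributes a factor `N^{-1/2}`, and so does each pair of
differences that is not matched by a pair of `A`. -/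
theorem exists_diffMon_bound (h : ℝ) (p k m₂ a m₁ : ℕ) (hk : 2 * p ≤ k) :
    ∃ C : ℝ, 0 ≤ C ∧ ∀ (β q : ℝ) (N n : ℕ), IsAdmissible h β q N n →
      ∀ A L₁ L₂ : List (ℕ × ℕ), IsPairList k A → IsPairList k L₁ → IsPairList k L₂ →
      A.length = a → L₁.length = m₁ → L₂.length = m₂ →
      |cavMean N n β h q k (fun σ => splitFun p A (pairProd (overlapDev N q) L₁) σ *
        pairProd (overlapDev N q) L₂ σ) 1| ≤
        C / √(N : ℝ) ^ (m₁ + m₂ + ((p + 1) / 2 - a)) := by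
  induction m₂ generalizing a m₁ with
  | zero =>
    obtain ⟨C, hC0, hC⟩ := exists_pathMeanDeriv_bound h ((p + 1) / 2 - a) m₁ k
    refine ⟨2 ^ p * C, by positivity, fun β q N n H A L₁ L₂ hA hL₁ _ ha hm₁ hm₂ => ?_⟩
    rw [List.length_eq_zero_iff.1 hm₂]
    simp only [pairProd_nil, mul_one, add_zero]
    set F := splitFun (n := n) p A (pairProd (overlapDev N q) L₁) with hFdef
    have hG : DependsOn (pairProd (overlapDev N q (n := n)) L₁) (Iio k) :=
      dependsOn_pairProd _ hL₁
    have hF : DependsOn F (Iio k) := dependsOn_splitFun hk hA hG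
    have hFB : ∀ σ, |F σ| ≤ 2 ^ p * |pairProd (cavDev N q) L₁ σ| := fun σ => by
      rw [hFdef, splitFun, abs_mul]
      exact mul_le_mul_of_nonneg_right (abs_unitMon_le _ _ _) (abs_nonneg _)
    have hd : ∀ t ∈ Icc (0 : ℝ) 1, _ := fun t ht =>
      hC β q N n H t ht F (2 ^ p) L₁ hF hL₁ hm₁ (by positivity) hFB
    rw [mul_div_assoc]
    -- the derivatives at `t = 0` of order less than `⌈p / 2⌉ - a` vanish
    rcases Nat.eq_zero_or_pos ((p + 1) / 2 - a) with h0 | h0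
    · have := hd 1 (right_mem_Icc.2 zero_le_one)
      rw [h0, pathMeanDeriv_zero] at this
      rwa [h0]
    · obtain ⟨r, hr⟩ := Nat.exists_eq_succ_of_ne_zero h0.ne'
      rw [hr] at hd ⊢
      have := abs_sub_taylor_le (contDiffOn_pathMean (β / √(N : ℝ)) h (β * √q) hF) r hd
      rwa [Finset.sum_eq_zero, sub_zero] at this
      intro j hj
      have hj' := Finset.mem_range.1 hj
      refine mul_eq_zero_of_right _ (pathMeanDeriv_splitFun_eq_zero _ _ _ j hk hA hG ?_)
      omega
  | succ m₂ ih =>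
    obtain ⟨C, hC0, hC⟩ := ih a (m₁ + 1)
    obtain ⟨C', hC'0, hC'⟩ := ih (a + 1) m₁
    refine ⟨C + C', by positivity, fun β q N n H A L₁ L₂ hA hL₁ hL₂ ha hm₁ hm₂ => ?_⟩
    obtain ⟨x, L, rfl⟩ := List.exists_cons_of_length_eq_add_one hm₂
    rw [isPairList_cons] at hL₂
    have hxA : IsPairList k (x :: A) := isPairList_cons.2 ⟨hL₂.1, hA⟩
    have hxL : IsPairList k (x :: L₁) := isPairList_cons.2 ⟨hL₂.1, hL₁⟩
    have e1 := hC β q N n H A (x :: L₁) L hA hxL hL₂.2 ha (by simp [hm₁]) (by simpa using hm₂)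
    have e2 := hC' β q N n H (x :: A) L₁ L hxA hL₁ hL₂.2 (by simp [ha]) hm₁ (by simpa using hm₂)
    have hN : (0 : ℝ) < N := lt_of_lt_of_le one_pos H.one_le_cast
    have hs : 1 ≤ √(N : ℝ) := Real.one_le_sqrt.2 H.one_le_cast
    have hs0 : 0 < √(N : ℝ) := one_pos.trans_le hs
    -- `R - q` is `R⁻ - q` plus the product of two last spins over `N`: the latter matches two more
    -- replicas, but the factor `1 / N` makes up for that
    have hdec : (fun σ : ℕ → Config (n + 1) => splitFun p A (pairProd (overlapDev N q) L₁) σ *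
        pairProd (overlapDev N q) (x :: L) σ) = fun σ =>
        splitFun p A (pairProd (overlapDev N q) (x :: L₁)) σ * pairProd (overlapDev N q) L σ +
        1 / (√(N : ℝ) ^ 2) * (splitFun p (x :: A) (pairProd (overlapDev N q) L₁) σ *
          pairProd (overlapDev N q) L σ) := by
      funext σ
      simp only [pairProd_cons, splitFun, unitMon, overlapDev_eq_cavDev (σ x.1) (σ x.2),
        Real.sq_sqrt hN.le]
      simp only [cavDev, lastProd, unitVal, spin]
      ring
    have d : DependsOn (pairProd (overlapDev N q (n := n + 1)) L) (Iio k) :=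
      dependsOn_pairProd _ hL₂.2
    rw [cavMean, hdec, pathMean_add 1
      (DependsOn.mul (dependsOn_splitFun hk hA (dependsOn_pairProd _ hxL)) d)
      (DependsOn.mul (fun _ _ _ => rfl)
        (DependsOn.mul (dependsOn_splitFun hk hxA (dependsOn_pairProd _ hL₁)) d)),
      pathMean_const_mul]
    refine (abs_add_le _ _).trans ?_
    rw [add_div, abs_mul, abs_of_nonneg (by positivity : (0 : ℝ) ≤ 1 / √(N : ℝ) ^ 2)]
    refine add_le_add (e1.trans_eq (by congr 2; ring)) ?_
    refine (mul_le_mul_of_nonneg_left e2 (by positivity)).trans ?_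
    rw [div_mul_div_comm, one_mul, ← pow_add]
    exact div_le_div_of_nonneg_left hC'0 (by positivity) (pow_le_pow_right₀ hs (by omega))

/-! ### Derivatives at the origin of the path and the expansion of order `p` -/

theorem abs_lastMean_le {h c : ℝ} {k : ℕ} {f : (ℕ → ℤˣ) → ℝ} {C : ℝ} (hf : ∀ ε, |f ε| ≤ C) :
    |lastMean h c k f| ≤ C := by
  have h1 : ∀ z, ‖avg k (lastWeight (c * z + h)) f‖ ≤ C := fun z =>
    ((abs_avg_le (lastWeight_nonneg _)).trans (avg_mono (lastWeight_nonneg _) hf)).trans_eq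
      (avg_const (sum_lastWeight _) C)
  simpa [lastMean] using norm_integral_le_of_norm_le_const (μ := gaussianReal 0 1) (ae_of_all _ h1)

/-- The derivatives at `t = 0` of order above `p / 2`. After the last spins are decoupled, the
differences at the first site are treated by the cavity method in the system of `N - 1` sites, and
this yields more factors `N^{-1/2}`. -/
theorem exists_pathMeanDeriv_zero_bound (h : ℝ) (p l m k : ℕ) (hk : 2 * p ≤ k)
    (hl : p < 2 * (m + l)) : ∃ C : ℝ, 0 ≤ C ∧ ∀ (β q : ℝ) (n : ℕ),
      IsAdmissible h β q (n + 2) (n + 1) → ∀ A L : List (ℕ × ℕ), IsPairList k A →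
      IsPairList k L → L.length = m →
      |pathMeanDeriv (n + 1) (β / √((n + 2 : ℕ) : ℝ)) h (β * √q) l k (splitFun p A fun ρ =>
        diffMon p (fun ρ => spin ρ 0) ρ * pairProd (overlapDev (n + 2) q) L ρ) 0| ≤
        C / √((n + 2 : ℕ) : ℝ) ^ (p + 1) := by
  induction l generalizing m k with
  | zero =>
    obtain ⟨C, hC0, hC⟩ := exists_diffMon_bound h p k m 0 0 hk
    refine ⟨2 ^ p * C, by positivity, fun β q n H A L _ hL hm => ?_⟩
    have H' : IsAdmissible h β q (n + 2) n :=
      ⟨H.nonneg, H.le, H.isOverlapParameter, by omega, le_rfl⟩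
    have hs : 1 ≤ √((n + 2 : ℕ) : ℝ) := Real.one_le_sqrt.2 H.one_le_cast
    have hs0 : 0 < √((n + 2 : ℕ) : ℝ) := one_pos.trans_le hs
    rw [pathMeanDeriv_zero]
    have hzero := pathMean_zero (n := n + 1) (β / √((n + 2 : ℕ) : ℝ)) h (β * √q) k (unitMon p A)
      fun ρ => diffMon p (fun ρ => spin ρ 0) ρ * pairProd (overlapDev (n + 2) q) L ρ
    refine (congrArg abs hzero).trans_le ?_
    have hsym := sysMean_perm (β / √((n + 2 : ℕ) : ℝ)) h (Equiv.swap 0 (Fin.last n)) k fun ρ =>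
        diffMon p (fun ρ => spin ρ 0) ρ * pairProd (overlapDev (n + 2) q) L ρ
    have hbd := hC β q (n + 2) n H' [] [] L (by simp [IsPairList]) (by simp [IsPairList]) hL rfl
      rfl hm
    rw [cavMean, pathMean_one] at hbd
    have heq : (fun ρ : ℕ → Config (n + 1) => diffMon p (fun ρ : Config (n + 1) => spin ρ 0)
        (fun r => ρ r ∘ Equiv.swap 0 (Fin.last n)) *
        pairProd (overlapDev (n + 2) q) L (fun r => ρ r ∘ Equiv.swap 0 (Fin.last n))) =
        fun σ => splitFun p [] (pairProd (overlapDev (n + 2) q) []) σ *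
          pairProd (overlapDev (n + 2) q) L σ := by
      funext σ
      simp only [splitFun, unitMon, pairProd, overlapDev_comp_perm, List.map_nil, List.prod_nil,
        mul_one]
      congr 1
    rw [abs_mul, ← hsym, heq, mul_div_assoc]
    refine mul_le_mul (abs_lastMean_le (abs_unitMon_le p A)) (hbd.trans ?_) (abs_nonneg _)
      (by positivity)
    exact div_le_div_of_nonneg_left hC0 (by positivity) (pow_le_pow_right₀ hs (by omega))
  | succ l ih =>
    obtain ⟨C, hC0, hC⟩ := ih (m + 1) (k + 2) (by omega) (by omega)
    refine ⟨totalWeight k * C, mul_nonneg (totalWeight_nonneg k) hC0,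
      fun β q n H A L hA hL hm => ?_⟩
    have hG : DependsOn (fun ρ : ℕ → Config (n + 1) => diffMon p (fun ρ => spin ρ 0) ρ *
        pairProd (overlapDev (n + 2) q) L ρ) (Iio k) :=
      DependsOn.mul (dependsOn_diffMon hk _) (dependsOn_pairProd _ hL)
    rw [pathMeanDeriv_succ l (dependsOn_splitFun hk hA hG) (left_mem_Icc.2 zero_le_one)]
    refine (Finset.abs_sum_le_sum_abs _ _).trans ?_
    rw [mul_div_assoc, totalWeight, Finset.sum_mul]
    refine Finset.sum_le_sum fun x hx => ?_
    rw [abs_mul]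
    refine mul_le_mul_of_nonneg_left ?_ (abs_nonneg _)
    simp only [Finset.mem_offDiag, Finset.mem_range] at hx
    have hx' : x.1 ≠ x.2 ∧ x.1 < k + 2 ∧ x.2 < k + 2 := ⟨hx.2.2, hx.1, hx.2.1⟩
    have hxA : IsPairList (k + 2) (x :: A) := isPairList_cons.2 ⟨hx', hA.mono (by omega)⟩
    have hxL : IsPairList (k + 2) (x :: L) := isPairList_cons.2 ⟨hx', hL.mono (by omega)⟩
    have hb := hC β q n H (x :: A) (x :: L) hxA hxL (by simp [hm])
    have heq : (fun σ : ℕ → Config (n + 1 + 1) => splitFun p A (fun ρ =>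
        diffMon p (fun ρ : Config (n + 1) => spin ρ 0) ρ *
          pairProd (overlapDev (n + 2) q) L ρ) σ *
        covDeriv (β / √((n + 2 : ℕ) : ℝ)) (β * √q) (σ x.1) (σ x.2)) = fun σ =>
        β ^ 2 / 2 * splitFun p (x :: A) (fun ρ => diffMon p (fun ρ => spin ρ 0) ρ *
          pairProd (overlapDev (n + 2) q) (x :: L) ρ) σ := by
      funext σ
      rw [covDeriv_eq H.isOverlapParameter.nonneg]
      simp only [splitFun, unitMon, pairProd_cons, cavDev, lastProd]
      simp only [unitVal, spin]
      ring
    have hconst : pathMeanDeriv (n + 1) (β / √((n + 2 : ℕ) : ℝ)) h (β * √q) l (k + 2)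
        (fun σ => β ^ 2 / 2 * splitFun p (x :: A) (fun ρ => diffMon p (fun ρ => spin ρ 0) ρ *
          pairProd (overlapDev (n + 2) q) (x :: L) ρ) σ) 0 = β ^ 2 / 2 *
        pathMeanDeriv (n + 1) (β / √((n + 2 : ℕ) : ℝ)) h (β * √q) l (k + 2)
          (splitFun p (x :: A) (fun ρ => diffMon p (fun ρ => spin ρ 0) ρ *
          pairProd (overlapDev (n + 2) q) (x :: L) ρ)) 0 := by
      unfold pathMeanDeriv
      rw [← iteratedDerivWithin_const_mul_field]
      congr 1
      funext t
      exact pathMean_const_mul _ t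
    rw [heq, hconst, abs_mul, abs_of_nonneg (by positivity)]
    have h1 : β ^ 2 / 2 ≤ 1 := by linarith [H.sq_le]
    calc _ ≤ 1 * (C / √((n + 2 : ℕ) : ℝ) ^ (p + 1)) :=
          mul_le_mul h1 hb (abs_nonneg _) zero_le_one
      _ = _ := one_mul _

/-- The function `diffProd`, for sequences of replicas. -/
def diffSeq (n p : ℕ) : (ℕ → Config (n + 1 + 1)) → ℝ :=
  splitFun p [] (diffMon p fun ρ => spin ρ 0)

theorem dependsOn_diffSeq (n p : ℕ) : DependsOn (diffSeq n p) (Iio (2 * p)) :=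
  dependsOn_splitFun le_rfl (by simp [IsPairList]) (dependsOn_diffMon le_rfl _)

theorem diffProd_eq (n p : ℕ) (σ : Fin (2 * p) → Config (n + 1 + 1)) :
    diffProd (n + 1) p σ = diffSeq n p (toSeq σ) := by
  have h : ∀ u : Config (n + 1 + 1) → ℝ, diffMon p u (toSeq σ) =
      ∏ r : Fin p, (u (σ ⟨2 * r, by omega⟩) - u (σ ⟨2 * r + 1, by omega⟩)) := fun u => by
    rw [diffMon, Finset.prod_range]
    refine Finset.prod_congr rfl fun r _ => ?_
    rw [toSeq_of_lt, toSeq_of_lt]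
  have h0 := h fun ρ => spin ρ 0
  have h1 := h fun ρ => spin ρ (Fin.last (n + 1))
  simp only [diffSeq, splitFun, unitMon, pairProd_nil, mul_one, diffProd, spinDiff]
  rw [← h0, ← h1]
  rfl

theorem nuPath_eq (n p : ℕ) (β h q : ℝ) :
    nuPath (n + 1) β h q (diffProd (n + 1) p) =
      cavMean (n + 2) (n + 1) β h q (2 * p) (diffSeq n p) := by
  funext t
  unfold nuPath cavMean pathMean
  refine integral_congr_ae (ae_of_all _ fun x => ?_)
  have hE : negHPath β h q t x.1 x.2 =
      pathEnergy (β / √((n + 2 : ℕ) : ℝ)) h (β * √q) t x.1 x.2 := by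
    funext σ
    have hn : √((n + 1 : ℕ) : ℝ) ≠ 0 := (Real.sqrt_pos.2 (by positivity)).ne'
    have hβ : β * √(((n + 1 : ℕ) : ℝ) / ((n + 1 + 1 : ℕ) : ℝ)) / √((n + 1 : ℕ) : ℝ) =
        β / √((n + 2 : ℕ) : ℝ) := by
      rw [Real.sqrt_div (Nat.cast_nonneg _)]
      field_simp
    simp only [negHPath, pathEnergy, negH, sysEnergy, hβ, cavityField]
    ring
  simp only [hE]
  rw [← bracket_comp_toSeq]
  congr 1
  funext σ
  exact diffProd_eq n p σ

theorem nu_eq (n p : ℕ) (β h q : ℝ) :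
    nu (n + 2) β h (diffProd (n + 1) p) =
      cavMean (n + 2) (n + 1) β h q (2 * p) (diffSeq n p) 1 := by
  rw [cavMean, pathMean_one]
  unfold nu sysMean
  refine integral_congr_ae (ae_of_all _ fun g => ?_)
  have hE : negH (n + 2) β h g = sysEnergy (β / √((n + 2 : ℕ) : ℝ)) h g := rfl
  simp only [hE]
  rw [← bracket_comp_toSeq]
  congr 1
  funext σ
  exact diffProd_eq n p σ

/-- Taylor's formula at `t = 0`: only the derivative of order `p / 2` contributes. -/
theorem exists_taylor_bound (h : ℝ) (p : ℕ) : ∃ C : ℝ, ∀ (β q : ℝ) (n : ℕ),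
    IsAdmissible h β q (n + 2) (n + 1) →
      |cavMean (n + 2) (n + 1) β h q (2 * p) (diffSeq n p) 1 -
        ∑ j ∈ Finset.range (p + 1), if 2 * j = p then (j ! : ℝ)⁻¹ *
          pathMeanDeriv (n + 1) (β / √((n + 2 : ℕ) : ℝ)) h (β * √q) j (2 * p) (diffSeq n p) 0
          else 0| ≤ C / √((n + 2 : ℕ) : ℝ) ^ (p + 1) := by
  obtain ⟨C, hC0, hC⟩ := exists_pathMeanDeriv_bound h (p + 1) 0 (2 * p)
  have hD : ∀ j, ∃ D : ℝ, 0 ≤ D ∧ ∀ (β q : ℝ) (n : ℕ), IsAdmissible h β q (n + 2) (n + 1) →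
      2 * j ≠ p → |pathMeanDeriv (n + 1) (β / √((n + 2 : ℕ) : ℝ)) h (β * √q) j (2 * p)
        (diffSeq n p) 0| ≤ D / √((n + 2 : ℕ) : ℝ) ^ (p + 1) := fun j => by
    rcases lt_or_ge p (2 * j) with hj | hj
    · obtain ⟨D, hD0, hD⟩ := exists_pathMeanDeriv_zero_bound h p j 0 (2 * p) le_rfl (by omega)
      refine ⟨D, hD0, fun β q n H _ => ?_⟩
      have := hD β q n H [] [] (by simp [IsPairList]) (by simp [IsPairList]) rfl
      simp only [pairProd_nil, mul_one] at this
      exact this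
    · refine ⟨0, le_rfl, fun β q n H hjp => ?_⟩
      rw [diffSeq, pathMeanDeriv_splitFun_eq_zero _ _ _ j le_rfl (by simp [IsPairList])
        (dependsOn_diffMon le_rfl _) (by simp only [List.length_nil]; omega)]
      simp
  choose D hD0 hD using hD
  refine ⟨2 ^ p * 2 ^ p * C + ∑ j ∈ Finset.range (p + 1), D j, fun β q n H => ?_⟩
  have hd : ∀ t ∈ Icc (0 : ℝ) 1, |pathMeanDeriv (n + 1) (β / √((n + 2 : ℕ) : ℝ)) h (β * √q) (p + 1)
      (2 * p) (diffSeq n p) t| ≤ 2 ^ p * 2 ^ p * C / √((n + 2 : ℕ) : ℝ) ^ (p + 1) := fun t ht => by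
    have := hC β q (n + 2) (n + 1) H t ht (diffSeq n p) (2 ^ p * 2 ^ p) []
      (dependsOn_diffSeq n p) (by simp [IsPairList]) rfl (by positivity) fun σ => ?_
    · rwa [zero_add, ← mul_div_assoc] at this
    · rw [pairProd_nil, abs_one, mul_one, diffSeq, splitFun, abs_mul]
      exact mul_le_mul (abs_unitMon_le _ _ _) (abs_diffMon_le p (fun ρ => abs_spin ρ 0) _)
        (abs_nonneg _) (by positivity)
  have ht := abs_sub_taylor_le (contDiffOn_pathMean (n := n + 1) (β / √((n + 2 : ℕ) : ℝ)) h (β * √q)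
    (dependsOn_diffSeq n p)) p hd
  set a : ℕ → ℝ := fun j => (j ! : ℝ)⁻¹ *
    pathMeanDeriv (n + 1) (β / √((n + 2 : ℕ) : ℝ)) h (β * √q) j (2 * p) (diffSeq n p) 0 with ha
  have hrest : |∑ j ∈ Finset.range (p + 1), (a j - if 2 * j = p then a j else 0)| ≤
      ∑ j ∈ Finset.range (p + 1), D j / √((n + 2 : ℕ) : ℝ) ^ (p + 1) := by
    refine (Finset.abs_sum_le_sum_abs _ _).trans (Finset.sum_le_sum fun j _ => ?_)
    split_ifs with hj
    · rw [sub_self, abs_zero]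
      exact div_nonneg (hD0 j) (by positivity)
    · rw [sub_zero, ha, abs_mul, abs_of_nonneg (by positivity)]
      have h1 : (j ! : ℝ)⁻¹ ≤ 1 := inv_le_one_of_one_le₀
        (by exact_mod_cast Nat.one_le_iff_ne_zero.2 (Nat.factorial_ne_zero j))
      calc _ ≤ 1 * (D j / √((n + 2 : ℕ) : ℝ) ^ (p + 1)) :=
            mul_le_mul h1 (hD j β q n H hj) (abs_nonneg _) zero_le_one
        _ = _ := one_mul _
  rw [add_div, Finset.sum_div]
  rw [Finset.sum_sub_distrib] at hrest
  refine le_trans ?_ (add_le_add ht hrest)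
  refine le_trans (le_of_eq ?_) (abs_add_le _ _)
  congr 1
  simp only [ha, pathMeanDeriv]
  ring

/-- The power of an average over two replicas is an average over independent pairs of replicas. -/
theorem avg_two_pow {S : Type*} [Inhabited S] [Fintype S] (w : S → ℝ) (u : S → S → ℝ) (p : ℕ) :
    avg 2 w (fun σ => u (σ 0) (σ 1)) ^ p =
      avg (2 * p) w fun σ => ∏ r ∈ Finset.range p, u (σ (2 * r)) (σ (2 * r + 1)) := by
  have h2 : ∀ (k : ℕ) (F : (ℕ → S) → ℝ), avg (k + 2) w F = ∑ b, w b * ∑ a, w a *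
      avg k w fun σ => F (Function.update (Function.update σ k a) (k + 1) b) := fun k F => by
    rw [avg_succ]
    refine Finset.sum_congr rfl fun b _ => ?_
    rw [avg_succ]
  induction p with
  | zero => simp [avg]
  | succ p ih =>
    rw [pow_succ, ih, show 2 * (p + 1) = 2 * p + 2 by ring, h2, h2, Finset.mul_sum]
    refine Finset.sum_congr rfl fun b _ => ?_
    rw [mul_left_comm]
    congr 1
    rw [Finset.mul_sum]
    refine Finset.sum_congr rfl fun a _ => ?_
    have h3 : ∀ σ : ℕ → S, ∏ r ∈ Finset.range (p + 1),
        u (Function.update (Function.update σ (2 * p) a) (2 * p + 1) b (2 * r))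
          (Function.update (Function.update σ (2 * p) a) (2 * p + 1) b (2 * r + 1)) =
        u a b * ∏ r ∈ Finset.range p, u (σ (2 * r)) (σ (2 * r + 1)) := fun σ => by
      rw [Finset.prod_range_succ, mul_comm]
      congr 1
      · simp
      · refine Finset.prod_congr rfl fun r hr => ?_
        have hr' := Finset.mem_range.1 hr
        simp only [Function.update_apply]
        rw [if_neg (by omega), if_neg (by omega), if_neg (by omega), if_neg (by omega)]
    simp only [h3, avg_const_mul]
    simp [avg]
    ring

/-- The moments of the symmetrised covariance do not depend on the sites. -/
theorem integral_symCov_pow (n p : ℕ) (β h : ℝ) {i j : Fin (n + 2)} (hij : i ≠ j) :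
    ∫ g, symCov (n + 2) β h g i j ^ p ∂couplingLaw (n + 2) =
      nu (n + 2) β h (diffProd (n + 1) p) := by
  rw [nu_eq n p β h 0, cavMean, pathMean_one]
  -- a permutation that sends the first site to `i` and the last one to `j`
  set j' := Equiv.swap 0 i j with hj'
  have hj0 : j' ≠ 0 := fun h0 => hij (by
    rw [hj', Equiv.swap_apply_eq_iff, Equiv.swap_apply_left] at h0
    exact h0.symm)
  let π : Equiv.Perm (Fin (n + 2)) := Equiv.swap 0 i * Equiv.swap (Fin.last (n + 1)) j'
  have hπ0 : π 0 = i := by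
    have h0 : (0 : Fin (n + 2)) ≠ Fin.last (n + 1) := (Fin.last_pos).ne
    simp only [π, Equiv.Perm.mul_apply]
    rw [Equiv.swap_apply_of_ne_of_ne h0 hj0.symm, Equiv.swap_apply_left]
  have hπ1 : π (Fin.last (n + 1)) = j := by
    simp only [π, Equiv.Perm.mul_apply]
    rw [Equiv.swap_apply_left, hj', Equiv.swap_apply_self]
  rw [← sysMean_perm _ h π]
  unfold sysMean
  refine integral_congr_ae (ae_of_all _ fun g => ?_)
  have hE : negH (n + 2) β h g = sysEnergy (β / √((n + 2 : ℕ) : ℝ)) h g := rfl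
  have h2 : symCov (n + 2) β h g i j = avg 2 (gibbs (sysEnergy (β / √((n + 2 : ℕ) : ℝ)) h g))
      fun σ => (spin (σ 0) i - spin (σ 1) i) * (spin (σ 0) j - spin (σ 1) j) := by
    rw [symCov, hE, ← bracket_comp_toSeq]
    rfl
  simp only [h2]
  rw [avg_two_pow _ fun σ τ => (spin σ i - spin τ i) * (spin σ j - spin τ j)]
  refine avg_congr fun σ => ?_
  simp only [diffSeq, splitFun, unitMon, pairProd_nil, mul_one, diffMon]
  rw [← Finset.prod_mul_distrib]
  refine Finset.prod_congr rfl fun r _ => ?_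
  have e0 : ∀ τ : Config (n + 2), spin (init (τ ∘ π)) 0 = spin τ i := fun τ => by
    rw [← hπ0]; rfl
  have e1 : ∀ τ : Config (n + 2), unitVal ((τ ∘ π) (Fin.last (n + 1))) = spin τ j := fun τ => by
    rw [← hπ1]; rfl
  rw [e0, e0, e1, e1, mul_comm]

theorem isO_of_le {β₀ h : ℝ} {k : ℕ} {F : ℕ → ℝ → ℝ → ℝ} {K : ℝ}
    (hF : ∀ β ∈ Icc 0 β₀, ∀ q : ℝ, IsOverlapParameter β h q → ∀ n : ℕ,
      |F (n + 1) β q| ≤ K / √((n + 2 : ℕ) : ℝ) ^ k) : IsO β₀ h k F := by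
  refine ⟨K, fun β hβ q hq n hn => ?_⟩
  obtain ⟨m, rfl⟩ := Nat.exists_eq_add_of_le' hn
  refine (hF β hβ q hq m).trans_eq ?_
  rw [Real.sqrt_eq_rpow, ← Real.rpow_natCast, ← Real.rpow_mul (Nat.cast_nonneg _)]
  congr 2
  ring

end SK

end

theorem mainTheorem3 :
    ∃ β₀ : ℝ, 0 < β₀ ∧ ∀ h : ℝ, 0 ≤ h →
      -- `t ↦ ν_t(ε̃^{⊗p} σ̃_1^{⊗p})` is smooth on `[0, 1]`
      (∀ β ∈ Icc 0 β₀, ∀ q : ℝ, SK.IsOverlapParameter β h q → ∀ n : ℕ, 1 ≤ n → ∀ p : ℕ,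
        ContDiffOn ℝ ∞ (SK.nuPath n β h q (SK.diffProd n p)) (Icc 0 1)) ∧
      -- the derivatives of order `l > p / 2` at `t = 0`
      (∀ p l : ℕ, p < 2 * l →
        SK.IsO β₀ h (p + 1) fun n β q => SK.nuZeroDeriv n β h q l (SK.diffProd n p)) ∧
      -- odd `p`
      (∀ p : ℕ, Odd p →
        SK.IsO β₀ h (p + 1) fun n β _ => SK.nu (n + 1) β h (SK.diffProd n p)) ∧
      -- even `p = 2m`
      (∀ m : ℕ,
        SK.IsO β₀ h (2 * m + 1) fun n β q =>
          SK.nu (n + 1) β h (SK.diffProd n (2 * m)) -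
            SK.nuZeroDeriv n β h q m (SK.diffProd n (2 * m)) / (m ! : ℝ)) ∧
      -- the odd moments of `N^{1/2} γ̃_{i,j}` tend to zero
      (∀ p : ℕ, Odd p → ∀ β ∈ Icc 0 β₀, ∀ δ : ℝ, 0 < δ → ∃ N₀ : ℕ, ∀ N : ℕ, N₀ ≤ N →
        ∀ i j : Fin N, i ≠ j →
          |∫ g, (√(N : ℝ) * SK.symCov N β h g i j) ^ p ∂SK.couplingLaw N| < δ) := by
  refine ⟨1 / 20, by norm_num, fun h _ => ?_⟩
  have hadm : ∀ β ∈ Icc (0 : ℝ) (1 / 20), ∀ q, SK.IsOverlapParameter β h q → ∀ n : ℕ,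
      SK.IsAdmissible h β q (n + 2) (n + 1) := fun β hβ q hq n =>
    ⟨hβ.1, hβ.2, hq, le_rfl, by omega⟩
  have hodd : ∀ p : ℕ, Odd p → ∃ K : ℝ, ∀ β ∈ Icc (0 : ℝ) (1 / 20), ∀ q,
      SK.IsOverlapParameter β h q → ∀ n : ℕ,
      |SK.nu (n + 2) β h (SK.diffProd (n + 1) p)| ≤ K / √((n + 2 : ℕ) : ℝ) ^ (p + 1) :=
    fun p hp => by
      obtain ⟨K, hK⟩ := SK.exists_taylor_bound h p
      refine ⟨K, fun β hβ q hq n => ?_⟩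
      have := hK β q n (hadm β hβ q hq n)
      rwa [Finset.sum_eq_zero fun j _ => if_neg fun hj => by
        obtain ⟨r, hr⟩ := hp
        omega, sub_zero, ← SK.nu_eq] at this
  refine ⟨fun β hβ q hq n hn p => ?_, fun p l hl => ?_, fun p hp => ?_, fun m => ?_,
    fun p hp β hβ δ hδ => ?_⟩
  · obtain ⟨m, rfl⟩ := Nat.exists_eq_add_of_le' hn
    rw [SK.nuPath_eq]
    exact SK.contDiffOn_pathMean _ _ _ (SK.dependsOn_diffSeq m p)
  · obtain ⟨K, -, hK⟩ := SK.exists_pathMeanDeriv_zero_bound h p l 0 (2 * p) le_rfl (by omega)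
    refine SK.isO_of_le (K := K) fun β hβ q hq n => ?_
    have := hK β q n (hadm β hβ q hq n) [] [] (by simp [SK.IsPairList]) (by simp [SK.IsPairList])
      rfl
    simp only [SK.pairProd_nil, mul_one] at this
    rw [SK.nuZeroDeriv, SK.nuPath_eq]
    exact this
  · obtain ⟨K, hK⟩ := hodd p hp
    exact SK.isO_of_le hK
  · obtain ⟨K, hK⟩ := SK.exists_taylor_bound h (2 * m)
    refine SK.isO_of_le (K := K) fun β hβ q hq n => ?_
    have := hK β q n (hadm β hβ q hq n)
    rw [Finset.sum_eq_single m (fun j _ hj => if_neg (by omega)) (fun hm => absurd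
      (Finset.mem_range.2 (by omega)) hm), if_pos rfl, ← SK.nu_eq] at this
    rw [SK.nuZeroDeriv, SK.nuPath_eq, div_eq_inv_mul]
    exact this
  · obtain ⟨K, hK⟩ := hodd p hp
    obtain ⟨q, -, hq⟩ := SK.exists_isOverlapParameter β h
    obtain ⟨N₀, hN₀⟩ := exists_nat_gt ((K / δ) ^ 2)
    refine ⟨N₀, fun N hN i j hij => ?_⟩
    have hN2 : 2 ≤ N := by
      by_contra hlt
      exact hij (Fin.ext (by omega))
    obtain ⟨n, rfl⟩ := Nat.exists_eq_add_of_le' hN2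
    have hs0 : 0 < √((n + 2 : ℕ) : ℝ) := Real.sqrt_pos.2 (by positivity)
    have hlt : K / δ < √((n + 2 : ℕ) : ℝ) :=
      Real.lt_sqrt_of_sq_lt (hN₀.trans_le (by exact_mod_cast hN))
    simp only [mul_pow]
    rw [integral_const_mul, SK.integral_symCov_pow n p β h hij, abs_mul,
      abs_of_nonneg (by positivity)]
    calc √((n + 2 : ℕ) : ℝ) ^ p * |SK.nu (n + 2) β h (SK.diffProd (n + 1) p)|
        ≤ √((n + 2 : ℕ) : ℝ) ^ p * (K / √((n + 2 : ℕ) : ℝ) ^ (p + 1)) :=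
          mul_le_mul_of_nonneg_left (hK β hβ q hq n) (by positivity)
      _ = K / √((n + 2 : ℕ) : ℝ) := by
          rw [pow_succ]
          field_simp
      _ < δ := by
          rw [div_lt_iff₀ hs0]
          rw [div_lt_iff₀ hδ] at hlt
          linarith
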